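/- Let $0<\alpha<2$, let $T$ be an arbitrary index set, let $\{X_t\}_{t\in T}$ be a symmetric $\alpha$-stable (S$\alpha$S) process and $\{Y_t\}_{t\in T}$ an $\alpha$-Fréchet process (real-valued, possibly defined on different probability spaces). That is, every finite linear combination $\sum_i a_iX_{t_i}$, $a_i\in\mathbb R$, has characteristic function $u\mapsto\exp(-\sigma^\alpha|u|^\alpha)$ for some scale $\sigma\ge 0$, and every finite max-linear combination $Z=\bigvee_i a_iY_{t_i}$, $a_i\ge 0$, is nonnegative a.s. with $\mathbb P(Z\le y)=\exp(-\sigma^\alpha y^{-\alpha})$ for all $y>0$, for some scale $\sigma\ge 0$ ($\sigma=0$ means that the variable is $0$ a.s.). Suppose that $X$ and $Y$ are associated by a family $\{f_t\}_{t\in T}$ of nonnegative functions in $L^\alpha(S,\mu)$, where $(S,\mu)$ is a measure space. This means that, in the sense of equality of all finite-dimensional distributions, $$\{X_t\}_{t\in T}\stackrel{d}{=}\Big\{\int_S f_t\,dM_{\alpha,+}\Big\}_{t\in T}\qquad\text{and}\qquad \{Y_t\}_{t\in T}\stackrel{d}{=}\Big\{\int^{e}_S f_t\,dM_{\alpha,\vee}\Big\}_{t\in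 T}.$$ Here $M_{\alpha,+}$ is an S$\alpha$S random measure with control measure $\mu$, i.e. a family of random variables $M_{\alpha,+}(A)$, indexed by the measurable sets $A$ with $\mu(A)<\infty$, that are independent on disjoint sets, a.s. countably additive, and such that $M_{\alpha,+}(A)$ is S$\alpha$S with scale $\mu(A)^{1/\alpha}$; $M_{\alpha,\vee}$ is an $\alpha$-Fréchet random sup-measure with control measure $\mu$, i.e. such a family that is independent on disjoint sets, satisfies $M_{\alpha,\vee}(\bigcup_j A_j)=\sup_jM_{\alpha,\vee}(A_j)$ a.s. for disjoint $A_j$, and such that $M_{\alpha,\vee}(A)$ is $\alpha$-Fréchet with scale $\mu(A)^{1/\alpha}$. The stable integral of a simple function $\sum_i a_i\mathbf 1_{A_i}$ ($A_i$ disjoint) is $\sum_i a_iM_{\alpha,+}(A_i)$ and extends to $L^\alpha(S,\mu)$ as the limit in probability along simple functions converging in $L^\alpha(S,\mu)$; the extremal integral of a nonnegative simple function $\sum_i a_i\mathbf 1_{A_i}$ ($A_i$ disjoint) is $\bigvee_i a_iM_{\alpha,\vee}(A_i)$ and extends to nonnegative $f\in L^\alpha(S,\mu)$ as the a.s. limit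 along nonnegative simple functions increasing to $f$ $\mu$-a.e. Then for all $t_1,t_2,\dots\in T$ and $t\in T$, as $n\to\infty$, $X_{t_n}\to X_t$ in probability if and only if $Y_{t_n}\to Y_t$ in probability. -/

import Mathlib

open MeasureTheory ProbabilityTheory Filter Topology

universe uT uS uΩ uX uY uP uM

namespace SumMaxStable


section Distributions

variable {Ω : Type uΩ} [MeasurableSpace Ω]

/-- `Z` is symmetric `α`-stable with scale coefficient `σ`: its characteristic function is
`u ↦ exp (-σ ^ α * |u| ^ α)`. The value `σ = 0` is the degenerate law at `0`. -/
def IsSaSWith (α σ : ℝ) (P : Measure Ω) (Z : Ω → ℝ) : Prop :=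
  AEMeasurable Z P ∧
    ∀ u : ℝ, charFun (P.map Z) u = Complex.exp ((-(σ ^ α * |u| ^ α) : ℝ) : ℂ)

/-- `Z` is `α`-Fréchet with scale coefficient `σ`: it is nonnegative and
`P (Z ≤ y) = exp (-σ ^ α * y ^ (-α))` for `y > 0`. The value `σ = 0` is the degenerate law
at `0`. (Nonnegativity follows from the formula when `σ > 0`.) -/
def IsFrechetWith (α σ : ℝ) (P : Measure Ω) (Z : Ω → ℝ) : Prop :=
  AEMeasurable Z P ∧ (∀ᵐ ω ∂P, 0 ≤ Z ω) ∧
    ∀ y : ℝ, 0 < y → P.real {ω | Z ω ≤ y} = Real.exp (-(σ ^ α * y ^ (-α)))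

/-- SαS process: every finite linear combination is SαS. -/
def IsSaSProcess {T : Type uT} (α : ℝ) (P : Measure Ω) (X : T → Ω → ℝ) : Prop :=
  ∀ (n : ℕ) (t : Fin n → T) (a : Fin n → ℝ),
    ∃ σ : ℝ, 0 ≤ σ ∧ IsSaSWith α σ P (fun ω => ∑ i, a i * X (t i) ω)

/-- `α`-Fréchet process: every finite max-linear combination with nonnegative coefficients
is `α`-Fréchet. -/
def IsFrechetProcess {T : Type uT} (α : ℝ) (P : Measure Ω) (Y : T → Ω → ℝ) : Prop :=
  ∀ (n : ℕ) (t : Fin (n + 1) → T) (a : Fin (n + 1) → ℝ), (∀ i, 0 ≤ a i) →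
    ∃ σ : ℝ, 0 ≤ σ ∧ IsFrechetWith α σ P
      (fun ω => Finset.univ.sup' Finset.univ_nonempty (fun i => a i * Y (t i) ω))

end Distributions

/-- Equality in law of two stochastic processes with the same index set, possibly on different
probability spaces: all finite-dimensional distributions agree. -/
def SameFDD {T : Type uT} {Ω : Type uΩ} [MeasurableSpace Ω] {Ω' : Type uP} [MeasurableSpace Ω']
    (P : Measure Ω) (P' : Measure Ω') (X : T → Ω → ℝ) (Z : T → Ω' → ℝ) : Prop :=
  ∀ I : Finset T,
    IdentDistrib (fun ω (i : I) => X i ω) (fun ω (i : I) => Z i ω) P P'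

section Integrals

variable {S : Type uS} [MeasurableSpace S] {Ω : Type uΩ} [MeasurableSpace Ω]

/-- The set-indexed family `M` is independently scattered: its values on disjoint measurable sets
of finite `μ`-measure are independent. -/
def IndependentlyScattered (μ : Measure S) (P : Measure Ω) (M : Set S → Ω → ℝ) : Prop :=
  ∀ (n : ℕ) (A : Fin n → Set S), (∀ i, MeasurableSet (A i)) → (∀ i, μ (A i) < ⊤) →
    Pairwise (fun i j => Disjoint (A i) (A j)) → iIndepFun (fun i => M (A i)) P

/-- `M` is an SαS random measure with control measure `μ`: defined on the measurable sets of
finite `μ`-measure (values elsewhere are irrelevant), independently scattered, almost surely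
countably additive, and `M A` is SαS with scale coefficient `μ(A) ^ (1 / α)`. -/
structure IsSaSRandomMeasure (α : ℝ) (μ : Measure S) (P : Measure Ω) (M : Set S → Ω → ℝ) :
    Prop where
  isSaS : ∀ A, MeasurableSet A → μ A < ⊤ → IsSaSWith α (μ.real A ^ (1 / α)) P (M A)
  indep : IndependentlyScattered μ P M
  sigma_additive : ∀ A : ℕ → Set S, (∀ j, MeasurableSet (A j)) →
    Pairwise (fun i j => Disjoint (A i) (A j)) → μ (⋃ j, A j) < ⊤ →
    ∀ᵐ ω ∂P, Tendsto (fun n => ∑ j ∈ Finset.range n, M (A j) ω) atTop (𝓝 (M (⋃ j, A j) ω))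

/-- `M` is an `α`-Fréchet random sup-measure with control measure `μ`: independently scattered,
almost surely countably sup-additive, and `M A` is `α`-Fréchet with scale coefficient
`μ(A) ^ (1 / α)`, on the measurable sets of finite `μ`-measure. -/
structure IsFrechetSupMeasure (α : ℝ) (μ : Measure S) (P : Measure Ω) (M : Set S → Ω → ℝ) :
    Prop where
  isFrechet : ∀ A, MeasurableSet A → μ A < ⊤ → IsFrechetWith α (μ.real A ^ (1 / α)) P (M A)
  indep : IndependentlyScattered μ P M
  sigma_sup_additive : ∀ A : ℕ → Set S, (∀ j, MeasurableSet (A j)) →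
    Pairwise (fun i j => Disjoint (A i) (A j)) → μ (⋃ j, A j) < ⊤ →
    ∀ᵐ ω ∂P, IsLUB (Set.range fun j => M (A j) ω) (M (⋃ j, A j) ω)

/-- The integral `∑ y, y * M {g = y}` of a simple function (the value `y = 0` contributes `0`). -/
noncomputable def simpleStableIntegral (M : Set S → Ω → ℝ) (g : SimpleFunc S ℝ) (ω : Ω) : ℝ :=
  ∑ y ∈ g.range, y * M (g ⁻¹' {y}) ω

/-- The extremal integral `max_y y * M {g = y}` of a nonnegative simple function (the value
`y = 0` contributes `0`; the maximum over no values is `0`). -/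
noncomputable def simpleExtremalIntegral (M : Set S → Ω → ℝ) (g : SimpleFunc S ℝ) (ω : Ω) : ℝ :=
  g.range.fold max 0 (fun y => y * M (g ⁻¹' {y}) ω)

/-- `Z` is (a version of) the stable integral `∫ f dM`: the limit in probability of the integrals
of simple functions that converge to `f` in `L^α(S, μ)`. -/
def IsStableIntegral (α : ℝ) (μ : Measure S) (P : Measure Ω) (M : Set S → Ω → ℝ)
    (f : S → ℝ) (Z : Ω → ℝ) : Prop :=
  ∃ g : ℕ → SimpleFunc S ℝ, (∀ n, (g n).FinMeasSupp μ) ∧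
    Tendsto (fun n => eLpNorm (fun s => g n s - f s) (ENNReal.ofReal α) μ) atTop (𝓝 0) ∧
    TendstoInMeasure P (fun n => simpleStableIntegral M (g n)) atTop Z

/-- `Z` is (a version of) the extremal integral of the nonnegative function `f` with respect to
the sup-measure `M`: the almost sure limit of the extremal integrals of nonnegative simple
functions that increase to `f` almost everywhere. -/
def IsExtremalIntegral (μ : Measure S) (P : Measure Ω) (M : Set S → Ω → ℝ)
    (f : S → ℝ) (Z : Ω → ℝ) : Prop :=
  ∃ g : ℕ → SimpleFunc S ℝ, (∀ n s, 0 ≤ g n s) ∧ (∀ n, (g n).FinMeasSupp μ) ∧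
    (∀ᵐ s ∂μ, Monotone (fun n => g n s) ∧ Tendsto (fun n => g n s) atTop (𝓝 (f s))) ∧
    ∀ᵐ ω ∂P, Tendsto (fun n => simpleExtremalIntegral M (g n) ω) atTop (𝓝 (Z ω))

end Integrals

section Association

variable {T : Type uT} {S : Type uS} [MeasurableSpace S]

/-- `{X_t}` has the same law as `{∫ f_t dM}` for an SαS random measure `M` with control measure
`μ`, living on some probability space. -/
def HasStableRepresentation {Ω : Type uΩ} [MeasurableSpace Ω] (α : ℝ) (μ : Measure S)
    (f : T → S → ℝ) (P : Measure Ω) (X : T → Ω → ℝ) : Prop :=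
  ∃ (Ω' : Type uP) (_ : MeasurableSpace Ω') (P' : Measure Ω') (M : Set S → Ω' → ℝ)
    (Z : T → Ω' → ℝ), IsProbabilityMeasure P' ∧ IsSaSRandomMeasure α μ P' M ∧
      (∀ t, IsStableIntegral α μ P' M (f t) (Z t)) ∧ SameFDD P P' X Z

/-- `{Y_t}` has the same law as the process of extremal integrals of the `f_t` with respect to an
`α`-Fréchet random sup-measure with control measure `μ`, living on some probability space. -/
def HasExtremalRepresentation {Ω : Type uΩ} [MeasurableSpace Ω] (α : ℝ) (μ : Measure S)
    (f : T → S → ℝ) (P : Measure Ω) (Y : T → Ω → ℝ) : Prop :=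
  ∃ (Ω' : Type uP) (_ : MeasurableSpace Ω') (P' : Measure Ω') (M : Set S → Ω' → ℝ)
    (Z : T → Ω' → ℝ), IsProbabilityMeasure P' ∧ IsFrechetSupMeasure α μ P' M ∧
      (∀ t, IsExtremalIntegral μ P' M (f t) (Z t)) ∧ SameFDD P P' Y Z

/-- `{X_t}` and `{Y_t}` are associated by the family `{f_t}` of nonnegative functions
in `L^α(S, μ)`. -/
structure AssociatedBy {ΩX : Type uX} [MeasurableSpace ΩX] {ΩY : Type uY} [MeasurableSpace ΩY]
    (α : ℝ) (μ : Measure S) (f : T → S → ℝ) (PX : Measure ΩX) (X : T → ΩX → ℝ)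
    (PY : Measure ΩY) (Y : T → ΩY → ℝ) : Prop where
  memLp : ∀ t, MemLp (f t) (ENNReal.ofReal α) μ
  nonneg : ∀ t, ∀ᵐ s ∂μ, 0 ≤ f t s
  stable : HasStableRepresentation.{uT, uS, uX, uP} α μ f PX X
  extremal : HasExtremalRepresentation.{uT, uS, uY, uM} α μ f PY Y

end Association

end SumMaxStable

/-! Write `f_n`, `f` for the kernels at `t n` and `t₀`. Both convergences are equivalent to
convergence of kernels.

By linearity `X (t n) - X t₀` is SαS with `σ^α = ∫ |f_n - f|^α dμ`. Hence it tends to `0` in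
probability iff this integral tends to `0` (`tendstoInMeasure_stable_iff`): the characteristic
function at `u = 1` gives one direction, a tail bound by the characteristic function near `0` the
other.

Extremal integrals respect maxima instead of differences: `max (Y (t n)) (Y t₀)` is Fréchet with
`σ^α = c_n = ∫ max(f_n, f)^α`. Put `b_n = ∫ f_n^α`, `a = ∫ f^α`, `e_n = ∫ |f_n^α - f^α|`; then `e_n
+ b_n + a = 2 c_n`. Convergence in probability forces `b_n, c_n → a`, so `e_n → 0`. Conversely `e_n
→ 0` forces `b_n, c_n → a`, and ordered variables whose Fréchet parameters have the same limit merge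
in probability (`tendsto_measureReal_le_sub_frechet`). Applied to the maximum and each of its two
arguments, this gives `tendstoInMeasure_extremal_iff`.

It remains that, for nonnegative kernels, `f_n → f` in `L^α` iff `f_n^α → f^α` in `L^1`. Both
directions come from `|a^p - b^p| ≤ C |a - b|^p + ε b^p`, used with `p = α` and with `p = 1/α`. -/

namespace SumMaxStable

open scoped ENNReal

/-- The functional `∫ |F| ^ α dμ`, i.e. the `α`-th power of the `L^α` (quasi-)norm. -/
noncomputable def lpPow {S : Type*} [MeasurableSpace S] (α : ℝ) (μ : Measure S) (F : S → ℝ) :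
    ℝ≥0∞ :=
  ∫⁻ s, ‖F s‖ₑ ^ α ∂μ

/-! ### Disjoint sequences of sets -/

section Sets

variable {S : Type*}

theorem pairwise_disjoint_preimage_singleton {S β : Type*} (k : S → β) :
    Pairwise (fun i j => Disjoint (k ⁻¹' {i}) (k ⁻¹' {j})) := fun i j hij =>
  Disjoint.preimage _ (by simpa using hij)

/-- The sequence `A, B, ∅, ∅, …`. -/
def pairSeq (A B : Set S) (j : ℕ) : Set S := if j = 0 then A else if j = 1 then B else ∅

theorem pairwise_disjoint_pairSeq {A B : Set S} (h : Disjoint A B) :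
    Pairwise (fun i j => Disjoint (pairSeq A B i) (pairSeq A B j)) := by
  intro i j hij
  unfold pairSeq
  split_ifs <;> first | omega | simp [h.symm]

theorem iUnion_pairSeq (A B : Set S) : ⋃ j, pairSeq A B j = A ∪ B := by
  ext s
  simp only [Set.mem_iUnion, Set.mem_union]
  constructor
  · rintro ⟨j, hj⟩
    unfold pairSeq at hj
    split_ifs at hj <;> simp_all
  · rintro (h | h)
    · exact ⟨0, by simpa [pairSeq]⟩
    · exact ⟨1, by simpa [pairSeq]⟩

theorem measurableSet_pairSeq [MeasurableSpace S] {A B : Set S} (hA : MeasurableSet A)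
    (hB : MeasurableSet B)
    (j : ℕ) : MeasurableSet (pairSeq A B j) := by
  unfold pairSeq; split_ifs <;> simp [hA, hB]

end Sets

/-- The fibre over `0` may have infinite measure, where `M` is uncontrolled; its coefficient removes
it. All other fibres have finite measure when the support does. -/
theorem simpleStableIntegral_eq_sum_filter {S : Type*} [MeasurableSpace S] {Ω : Type*}
    (M : Set S → Ω → ℝ) (g : SimpleFunc S ℝ) :
    simpleStableIntegral M g =
      fun ω => ∑ y : {y // y ∈ g.range.filter (· ≠ 0)}, y.1 * M (g ⁻¹' {y.1}) ω := by
  funext ω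
  rw [Finset.sum_coe_sort (g.range.filter (· ≠ 0)) (fun y => y * M (g ⁻¹' {y}) ω)]
  refine (Finset.sum_filter_of_ne fun (y : ℝ) _ h => ?_).symm
  rintro rfl
  simp at h

/-! ### Stable integrals of simple functions -/

section Integrals

variable {S : Type*} [MeasurableSpace S] {Ω : Type*} [MeasurableSpace Ω]
  {α : ℝ} {μ : Measure S} {P : Measure Ω} {M : Set S → Ω → ℝ}

theorem lpPow_simpleFunc_toReal (hα : 0 < α) (g : SimpleFunc S ℝ) (hg : g.FinMeasSupp μ) :
    (lpPow α μ g).toReal = ∑ y ∈ g.range with y ≠ 0, |y| ^ α * μ.real (g ⁻¹' {y}) := by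
  have h1 : lpPow α μ g = ∑ y ∈ g.range, ‖y‖ₑ ^ α * μ (g ⁻¹' {y}) := by
    rw [← SimpleFunc.map_lintegral (fun y : ℝ => ‖y‖ₑ ^ α) g, ← SimpleFunc.lintegral_eq_lintegral]
    rfl
  have h2 : lpPow α μ g = ∑ y ∈ g.range with y ≠ 0, ‖y‖ₑ ^ α * μ (g ⁻¹' {y}) := by
    rw [h1]
    refine (Finset.sum_filter_of_ne fun (y : ℝ) _ h => ?_).symm
    rintro rfl
    simp [hα] at h
  rw [h2, ENNReal.toReal_sum]
  · refine Finset.sum_congr rfl fun y _ => ?_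
    rw [ENNReal.toReal_mul, ← ENNReal.toReal_rpow]
    simp [Measure.real]
  · intro y hy
    rw [Finset.mem_filter] at hy
    refine ENNReal.mul_ne_top (ENNReal.rpow_ne_top_of_nonneg hα.le (by simp)) ?_
    exact (SimpleFunc.finMeasSupp_iff.1 hg y hy.2).ne

theorem IndependentlyScattered.iIndepFun {ι : Type*} [Fintype ι]
    (h : IndependentlyScattered μ P M) (A : ι → Set S) (hA : ∀ i, MeasurableSet (A i))
    (hμ : ∀ i, μ (A i) < ⊤) (hd : Pairwise (fun i j => Disjoint (A i) (A j))) :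
    iIndepFun (fun i => M (A i)) P := by
  have e := Fintype.equivFin ι
  have := (h _ (fun k => A (e.symm k)) (fun k => hA _) (fun k => hμ _)
    (fun i j hij => hd (e.symm.injective.ne hij))).precomp e.injective
  simpa [Function.comp_def] using this

theorem map_preimage_singleton_eq_biUnion {β : Type*} (k : SimpleFunc S β)
    (φ : β → ℝ) (y : ℝ) :
    (k.map φ) ⁻¹' {y} = ⋃ b ∈ k.range.filter (fun b => φ b = y), k ⁻¹' {b} := by
  ext s
  simp

namespace IsSaSRandomMeasure

/-- The partial sums along `∅, ∅, …` are `n * M ∅`. They converge, so their increments, all equal to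
`M ∅`, tend to `0`. -/
theorem empty (hM : IsSaSRandomMeasure α μ P M) : ∀ᵐ ω ∂P, M ∅ ω = 0 := by
  have := hM.sigma_additive (fun _ => ∅) (by simp) (fun i j _ => by simp) (by simp)
  filter_upwards [this] with ω hω
  simp only [Set.iUnion_empty, Finset.sum_const, Finset.card_range, nsmul_eq_mul] at hω
  have h1 := (hω.comp (tendsto_add_atTop_nat 1)).sub hω
  simp only [Function.comp_def, sub_self] at h1
  refine tendsto_nhds_unique (tendsto_const_nhds.congr fun n => ?_) h1
  push_cast; ring

theorem union (hM : IsSaSRandomMeasure α μ P M) {A B : Set S} (hA : MeasurableSet A)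
    (hB : MeasurableSet B) (hd : Disjoint A B) (hμ : μ (A ∪ B) < ⊤) :
    ∀ᵐ ω ∂P, M (A ∪ B) ω = M A ω + M B ω := by
  have := hM.sigma_additive (pairSeq A B) (measurableSet_pairSeq hA hB)
    (pairwise_disjoint_pairSeq hd) (by rwa [iUnion_pairSeq])
  filter_upwards [this, hM.empty] with ω hω h0
  rw [iUnion_pairSeq] at hω
  refine tendsto_nhds_unique (hω.comp (tendsto_add_atTop_nat 2))
    (tendsto_const_nhds.congr fun n => ?_)
  simp only [Function.comp_apply]
  rw [add_comm n 2, Finset.sum_range_add]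
  have : ∀ x, 2 + x ≠ 1 := by omega
  simp [Finset.sum_range_succ, pairSeq, h0, this]

theorem biUnion (hM : IsSaSRandomMeasure α μ P M) {ι : Type*} (A : ι → Set S)
    (hA : ∀ i, MeasurableSet (A i)) (hd : Pairwise (fun i j => Disjoint (A i) (A j)))
    (s : Finset ι) (hμ : ∀ i ∈ s, μ (A i) < ⊤) :
    ∀ᵐ ω ∂P, M (⋃ i ∈ s, A i) ω = ∑ i ∈ s, M (A i) ω := by
  classical
  induction s using Finset.induction_on with
  | empty => simpa using hM.empty
  | insert i s hi ih =>
    have hμ' : ∀ i ∈ s, μ (A i) < ⊤ := fun j hj => hμ j (Finset.mem_insert_of_mem hj)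
    rw [Finset.set_biUnion_insert]
    have hdis : Disjoint (A i) (⋃ j ∈ s, A j) := by
      simp only [Set.disjoint_iUnion_right]
      exact fun j hj => hd (fun h => hi (h ▸ hj))
    have hfin : μ (A i ∪ ⋃ j ∈ s, A j) < ⊤ := by
      refine measure_union_lt_top (hμ i (Finset.mem_insert_self i s)) ?_
      exact (measure_biUnion_lt_top s.finite_toSet hμ')
    filter_upwards [ih hμ', hM.union (hA i) (s.measurableSet_biUnion fun j _ => hA j) hdis hfin]
      with ω h1 h2
    rw [h2, h1, Finset.sum_insert hi]

/-- Finite additivity allows the integral to be computed on any finer partition. Two simple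
functions can thus be integrated over the common partition given by their pairing. -/
theorem simpleStableIntegral_map (hM : IsSaSRandomMeasure α μ P M) {β : Type*}
    (k : SimpleFunc S β) (φ : β → ℝ) (hφ : (k.map φ).FinMeasSupp μ) :
    ∀ᵐ ω ∂P, simpleStableIntegral M (k.map φ) ω = ∑ b ∈ k.range, φ b * M (k ⁻¹' {b}) ω := by
  classical
  have key : ∀ y ∈ (k.map φ).range, y ≠ 0 → ∀ᵐ ω ∂P,
      M ((k.map φ) ⁻¹' {y}) ω = ∑ b ∈ k.range with φ b = y, M (k ⁻¹' {b}) ω := by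
    intro y _ hy
    rw [map_preimage_singleton_eq_biUnion]
    refine hM.biUnion _ (fun b => k.measurableSet_fiber b)
      (pairwise_disjoint_preimage_singleton k) _ fun b hb => ?_
    refine (measure_mono ?_).trans_lt (SimpleFunc.finMeasSupp_iff.1 hφ y hy)
    rw [map_preimage_singleton_eq_biUnion]
    exact Set.subset_biUnion_of_mem (u := fun b => k ⁻¹' {b}) hb
  have key' : ∀ᵐ ω ∂P, ∀ y ∈ (k.map φ).range, y ≠ 0 →
      M ((k.map φ) ⁻¹' {y}) ω = ∑ b ∈ k.range with φ b = y, M (k ⁻¹' {b}) ω := by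
    rw [eventually_all_finset]
    intro y hy
    by_cases h0 : y = 0
    · simp [h0]
    · filter_upwards [key y hy h0] with ω hω _ using hω
  filter_upwards [key'] with ω hω
  unfold simpleStableIntegral
  have : ∀ y ∈ (k.map φ).range, y * M ((k.map φ) ⁻¹' {y}) ω =
      ∑ b ∈ k.range with φ b = y, φ b * M (k ⁻¹' {b}) ω := by
    intro y hy
    by_cases h0 : y = 0
    · rw [h0, zero_mul]
      refine (Finset.sum_eq_zero fun b hb => ?_).symm
      rw [(Finset.mem_filter.1 hb).2, zero_mul]
    · rw [hω y hy h0, Finset.mul_sum]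
      refine Finset.sum_congr rfl fun b hb => ?_
      rw [(Finset.mem_filter.1 hb).2]
  rw [Finset.sum_congr rfl this]
  refine Finset.sum_fiberwise_of_maps_to (fun b hb => ?_) _
  rw [SimpleFunc.range_map]
  exact Finset.mem_image_of_mem _ hb

theorem simpleStableIntegral_sub (hM : IsSaSRandomMeasure α μ P M) (g h : SimpleFunc S ℝ)
    (hg : g.FinMeasSupp μ) (hh : h.FinMeasSupp μ) :
    ∀ᵐ ω ∂P, simpleStableIntegral M (g - h) ω =
      simpleStableIntegral M g ω - simpleStableIntegral M h ω := by
  have hp := hg.pair hh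
  have e1 : (g.pair h).map Prod.fst = g := by ext; rfl
  have e2 : (g.pair h).map Prod.snd = h := by ext; rfl
  have e3 : (g.pair h).map (fun p => p.1 - p.2) = g - h := by ext; rfl
  filter_upwards [hM.simpleStableIntegral_map (g.pair h) Prod.fst (by rwa [e1]),
    hM.simpleStableIntegral_map (g.pair h) Prod.snd (by rwa [e2]),
    hM.simpleStableIntegral_map (g.pair h) (fun p => p.1 - p.2) (hp.map (by simp))]
    with ω h1 h2 h3
  rw [e1] at h1
  rw [e2] at h2
  rw [e3] at h3
  rw [h1, h2, h3, ← Finset.sum_sub_distrib]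
  simp [sub_mul]

theorem aemeasurable_simpleStableIntegral (hM : IsSaSRandomMeasure α μ P M)
    (g : SimpleFunc S ℝ) (hg : g.FinMeasSupp μ) : AEMeasurable (simpleStableIntegral M g) P := by
  rw [simpleStableIntegral_eq_sum_filter]
  refine Finset.aemeasurable_fun_sum _ fun y _ => AEMeasurable.const_mul ?_ _
  exact (hM.isSaS _ (g.measurableSet_fiber _)
    (SimpleFunc.finMeasSupp_iff.1 hg _ (Finset.mem_filter.1 y.2).2)).1

/-- The values on distinct fibres are independent, so characteristic functions multiply and the
exponents `|y|^α μ(g = y) |u|^α` add up. -/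
theorem charFun_simpleStableIntegral (hα : 0 < α) (hM : IsSaSRandomMeasure α μ P M)
    (g : SimpleFunc S ℝ) (hg : g.FinMeasSupp μ) (u : ℝ) :
    charFun (P.map (simpleStableIntegral M g)) u =
      Complex.exp ((-((lpPow α μ g).toReal * |u| ^ α) : ℝ) : ℂ) := by
  have hfin : ∀ y : {y // y ∈ g.range.filter (· ≠ 0)}, μ (g ⁻¹' {y.1}) < ⊤ := fun y =>
    SimpleFunc.finMeasSupp_iff.1 hg _ (Finset.mem_filter.1 y.2).2
  have hlaw := fun y : {y // y ∈ g.range.filter (· ≠ 0)} =>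
    hM.isSaS _ (g.measurableSet_fiber y.1) (hfin y)
  have hind : iIndepFun (fun (y : {y // y ∈ g.range.filter (· ≠ 0)}) => M (g ⁻¹' {y.1})) P :=
    hM.indep.iIndepFun _ (fun y => g.measurableSet_fiber y.1) hfin
      (fun i j hij => pairwise_disjoint_preimage_singleton g (Subtype.coe_injective.ne hij))
  have hind' := hind.comp (fun y x => y.1 * x) (fun y => measurable_const_mul _)
  rw [simpleStableIntegral_eq_sum_filter]
  have := hind'.charFun_map_fun_sum_eq_prod (fun y => (hlaw y).1.const_mul _)
  simp only at this
  rw [this, Finset.prod_apply, lpPow_simpleFunc_toReal hα g hg, Finset.sum_mul,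
    ← Finset.sum_coe_sort (g.range.filter (· ≠ 0)), ← Finset.sum_neg_distrib, Complex.ofReal_sum,
    Complex.exp_sum]
  refine Finset.prod_congr rfl fun y _ => ?_
  rw [charFun_map_mul_comp (hlaw y).1, (hlaw y).2]
  congr 3
  rw [← Real.rpow_mul measureReal_nonneg, one_div_mul_cancel hα.ne', Real.rpow_one, abs_mul,
    Real.mul_rpow (abs_nonneg _) (abs_nonneg _)]
  ring

end IsSaSRandomMeasure

end Integrals

/-! ### Extremal integrals of simple functions -/

section ExtremalIntegrals

variable {S : Type*} [MeasurableSpace S] {Ω : Type*} [MeasurableSpace Ω]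
  {α : ℝ} {μ : Measure S} {P : Measure Ω} {M : Set S → Ω → ℝ}

theorem simpleExtremalIntegral_nonneg {S : Type*} [MeasurableSpace S] {Ω : Type*}
    (M : Set S → Ω → ℝ) (g : SimpleFunc S ℝ) (ω : Ω) : 0 ≤ simpleExtremalIntegral M g ω :=
  (Finset.le_fold_max 0).2 (Or.inl le_rfl)

theorem simpleExtremalIntegral_le_iff {S : Type*} [MeasurableSpace S] {Ω : Type*}
    (M : Set S → Ω → ℝ) (g : SimpleFunc S ℝ) (ω : Ω) {c : ℝ} (hc : 0 ≤ c) :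
    simpleExtremalIntegral M g ω ≤ c ↔ ∀ y ∈ g.range, y * M (g ⁻¹' {y}) ω ≤ c := by
  simp [simpleExtremalIntegral, Finset.fold_max_le, hc]

namespace IsFrechetSupMeasure

theorem nonneg (hM : IsFrechetSupMeasure α μ P M) {A : Set S} (hA : MeasurableSet A)
    (hμ : μ A < ⊤) : ∀ᵐ ω ∂P, 0 ≤ M A ω :=
  (hM.isFrechet A hA hμ).2.1

/-- Sup-additivity along `∅, ∅, …` is vacuous, so the law is used: the scale is `0`, hence `M ∅ ≤ 1
/ (n + 1)` almost surely for every `n`. -/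
theorem empty [IsProbabilityMeasure P] (hα : 0 < α) (hM : IsFrechetSupMeasure α μ P M) :
    ∀ᵐ ω ∂P, M ∅ ω = 0 := by
  obtain ⟨hm, h0, h⟩ := hM.isFrechet ∅ .empty (by simp)
  have h1 : ∀ n : ℕ, ∀ᵐ ω ∂P, M ∅ ω ≤ 1 / ((n : ℝ) + 1) := by
    intro n
    have hn := h (1 / ((n : ℝ) + 1)) (by positivity)
    have e : ((0 : ℝ) ^ (1 / α)) ^ α = 0 := by
      rw [Real.zero_rpow (one_div_pos.2 hα).ne', Real.zero_rpow hα.ne']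
    rw [measureReal_empty, e, zero_mul, neg_zero, Real.exp_zero] at hn
    have hset : NullMeasurableSet {ω | M ∅ ω ≤ 1 / ((n : ℝ) + 1)} P :=
      hm.nullMeasurableSet_preimage measurableSet_Iic
    rw [Measure.real, ENNReal.toReal_eq_one_iff] at hn
    exact (mem_ae_iff_prob_eq_one₀ hset).2 hn
  filter_upwards [h0, ae_all_iff.2 h1] with ω hω hn
  exact le_antisymm (ge_of_tendsto' tendsto_one_div_add_atTop_nhds_zero_nat hn) hω

/-- Maxima are described by their upper bounds `c`, which handles empty index sets uniformly. The
restriction `0 ≤ c` accommodates the value `0` of `M ∅`. -/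
theorem union_le_iff [IsProbabilityMeasure P] (hα : 0 < α) (hM : IsFrechetSupMeasure α μ P M)
    {A B : Set S} (hA : MeasurableSet A) (hB : MeasurableSet B) (hd : Disjoint A B)
    (hμ : μ (A ∪ B) < ⊤) :
    ∀ᵐ ω ∂P, ∀ c, 0 ≤ c → (M (A ∪ B) ω ≤ c ↔ M A ω ≤ c ∧ M B ω ≤ c) := by
  have := hM.sigma_sup_additive (pairSeq A B) (measurableSet_pairSeq hA hB)
    (pairwise_disjoint_pairSeq hd) (by rwa [iUnion_pairSeq])
  filter_upwards [this, hM.empty hα] with ω hω h0 c hc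
  rw [iUnion_pairSeq] at hω
  rw [isLUB_le_iff hω, mem_upperBounds, Set.forall_mem_range]
  constructor
  · exact fun h => ⟨by simpa [pairSeq] using h 0, by simpa [pairSeq] using h 1⟩
  · rintro ⟨h1, h2⟩ j
    unfold pairSeq
    split_ifs
    · exact h1
    · exact h2
    · rwa [h0]

theorem biUnion_le_iff [IsProbabilityMeasure P] (hα : 0 < α) (hM : IsFrechetSupMeasure α μ P M)
    {ι : Type*} (A : ι → Set S)
    (hA : ∀ i, MeasurableSet (A i)) (hd : Pairwise (fun i j => Disjoint (A i) (A j)))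
    (s : Finset ι) (hμ : ∀ i ∈ s, μ (A i) < ⊤) :
    ∀ᵐ ω ∂P, ∀ c, 0 ≤ c → (M (⋃ i ∈ s, A i) ω ≤ c ↔ ∀ i ∈ s, M (A i) ω ≤ c) := by
  classical
  induction s using Finset.induction_on with
  | empty =>
    filter_upwards [hM.empty hα] with ω hω c hc
    simpa [hω] using hc
  | insert i s hi ih =>
    have hμ' : ∀ i ∈ s, μ (A i) < ⊤ := fun j hj => hμ j (Finset.mem_insert_of_mem hj)
    rw [Finset.set_biUnion_insert]
    have hdis : Disjoint (A i) (⋃ j ∈ s, A j) := by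
      simp only [Set.disjoint_iUnion_right]
      exact fun j hj => hd (fun h => hi (h ▸ hj))
    have hfin : μ (A i ∪ ⋃ j ∈ s, A j) < ⊤ := by
      refine measure_union_lt_top (hμ i (Finset.mem_insert_self i s)) ?_
      exact (measure_biUnion_lt_top s.finite_toSet hμ')
    filter_upwards [ih hμ',
      hM.union_le_iff hα (hA i) (s.measurableSet_biUnion fun j _ => hA j) hdis hfin]
      with ω h1 h2 c hc
    rw [h2 c hc, h1 c hc, Finset.forall_mem_insert]

theorem simpleExtremalIntegral_map_le_iff [IsProbabilityMeasure P] (hα : 0 < α)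
    (hM : IsFrechetSupMeasure α μ P M) {β : Type*}
    (k : SimpleFunc S β) (φ : β → ℝ) (hφ : (k.map φ).FinMeasSupp μ)
    (hφ0 : ∀ b ∈ k.range, 0 ≤ φ b) :
    ∀ᵐ ω ∂P, ∀ c, 0 ≤ c → (simpleExtremalIntegral M (k.map φ) ω ≤ c ↔
      ∀ b ∈ k.range, φ b * M (k ⁻¹' {b}) ω ≤ c) := by
  classical
  have key' : ∀ᵐ ω ∂P, ∀ y ∈ (k.map φ).range, y ≠ 0 → ∀ c, 0 ≤ c →
      (M ((k.map φ) ⁻¹' {y}) ω ≤ c ↔ ∀ b ∈ k.range.filter (fun b => φ b = y),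
        M (k ⁻¹' {b}) ω ≤ c) := by
    rw [eventually_all_finset]
    intro y hy
    by_cases h0 : y = 0
    · simp [h0]
    · rw [map_preimage_singleton_eq_biUnion]
      filter_upwards [hM.biUnion_le_iff hα _ (fun b => k.measurableSet_fiber b)
        (pairwise_disjoint_preimage_singleton k) (k.range.filter (fun b => φ b = y)) fun b hb => by
          refine (measure_mono ?_).trans_lt (SimpleFunc.finMeasSupp_iff.1 hφ y h0)
          rw [map_preimage_singleton_eq_biUnion]
          exact Set.subset_biUnion_of_mem (u := fun b => k ⁻¹' {b}) hb] with ω hω _ using hω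
  filter_upwards [key'] with ω hω c hc
  rw [simpleExtremalIntegral_le_iff _ _ _ hc, SimpleFunc.range_map, Finset.forall_mem_image]
  have key : ∀ y ∈ (k.map φ).range, y * M ((k.map φ) ⁻¹' {y}) ω ≤ c ↔
      ∀ b ∈ k.range.filter (fun b => φ b = y), φ b * M (k ⁻¹' {b}) ω ≤ c := by
    intro y hy
    have hy' := hy
    rw [SimpleFunc.range_map, Finset.mem_image] at hy'
    obtain ⟨b₀, hb₀, rfl⟩ := hy'
    -- Over the value `0` the fibre may have infinite measure, but the factor `0` makes both sides
    -- trivially true.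
    rcases (hφ0 b₀ hb₀).eq_or_lt with h0 | h0
    · rw [← h0]
      simp only [zero_mul, hc, true_iff]
      intro b hb
      rw [(Finset.mem_filter.1 hb).2, zero_mul]
      exact hc
    · rw [mul_comm, ← le_div_iff₀ h0, hω _ hy h0.ne' _ (by positivity)]
      refine forall₂_congr fun b hb => ?_
      rw [(Finset.mem_filter.1 hb).2, le_div_iff₀ h0, mul_comm]
  constructor
  · intro h b hb
    exact (key (φ b) (by rw [SimpleFunc.range_map]; exact Finset.mem_image_of_mem _ hb)).1
      (h hb) b (Finset.mem_filter.2 ⟨hb, rfl⟩)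
  · intro h b hb
    refine (key (φ b) (by rw [SimpleFunc.range_map]; exact Finset.mem_image_of_mem _ hb)).2 ?_
    exact fun b' hb' => h b' (Finset.mem_filter.1 hb').1

theorem simpleExtremalIntegral_sup [IsProbabilityMeasure P] (hα : 0 < α)
    (hM : IsFrechetSupMeasure α μ P M) (g h : SimpleFunc S ℝ)
    (hg : g.FinMeasSupp μ) (hh : h.FinMeasSupp μ) (hg0 : ∀ s, 0 ≤ g s) (hh0 : ∀ s, 0 ≤ h s) :
    ∀ᵐ ω ∂P, simpleExtremalIntegral M (g ⊔ h) ω =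
      max (simpleExtremalIntegral M g ω) (simpleExtremalIntegral M h ω) := by
  have hp := hg.pair hh
  have e1 : (g.pair h).map Prod.fst = g := by ext; rfl
  have e2 : (g.pair h).map Prod.snd = h := by ext; rfl
  have e3 : (g.pair h).map (fun p => p.1 ⊔ p.2) = g ⊔ h := by ext; rfl
  have hr : ∀ b ∈ (g.pair h).range, 0 ≤ b.1 ∧ 0 ≤ b.2 := by
    -- Every value of the pairing is attained, so it inherits nonnegativity from `g` and `h`.
    intro b hb
    obtain ⟨s, rfl⟩ := SimpleFunc.mem_range.1 hb
    exact ⟨hg0 s, hh0 s⟩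
  have hr' : ∀ b ∈ (g.pair h).range, 0 ≤ b.1 ⊔ b.2 := fun b hb => le_sup_of_le_left (hr b hb).1
  have hpos : ∀ᵐ ω ∂P, ∀ b ∈ (g.pair h).range, b ≠ 0 → 0 ≤ M ((g.pair h) ⁻¹' {b}) ω := by
    rw [eventually_all_finset]
    intro b _
    by_cases hb : b = 0
    · simp [hb]
    · filter_upwards [hM.nonneg ((g.pair h).measurableSet_fiber b)
        (SimpleFunc.finMeasSupp_iff.1 hp b hb)] with ω hω _ using hω
  filter_upwards [hpos,
    hM.simpleExtremalIntegral_map_le_iff hα (g.pair h) Prod.fst (by rwa [e1])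
      (fun b hb => (hr b hb).1),
    hM.simpleExtremalIntegral_map_le_iff hα (g.pair h) Prod.snd (by rwa [e2])
      (fun b hb => (hr b hb).2),
    hM.simpleExtremalIntegral_map_le_iff hα (g.pair h) (fun p => p.1 ⊔ p.2) (hp.map (by simp)) hr']
    with ω h0 h1 h2 h3
  rw [e1] at h1
  rw [e2] at h2
  rw [e3] at h3
  refine eq_of_forall_ge_iff fun c => ?_
  by_cases hc : 0 ≤ c
  · rw [max_le_iff, h1 c hc, h2 c hc, h3 c hc, ← forall₂_and]
    refine forall₂_congr fun b hb => ?_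
    by_cases hb0 : b = 0
    · simp [hb0]
    -- Multiplication by `M` of the fibre commutes with `max` only because that value is almost
    -- surely nonnegative.
    · rw [max_mul_of_nonneg _ _ (h0 b hb hb0), max_le_iff]
  · have h1 := simpleExtremalIntegral_nonneg M (g ⊔ h) ω
    have h2 := simpleExtremalIntegral_nonneg M g ω
    rw [max_le_iff]
    constructor <;> intro <;> exfalso <;> grind

theorem aemeasurable_simpleExtremalIntegral (hM : IsFrechetSupMeasure α μ P M)
    (g : SimpleFunc S ℝ) (hg : g.FinMeasSupp μ) : AEMeasurable (simpleExtremalIntegral M g) P := by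
  have key : ∀ s : Finset ℝ, AEMeasurable
      (fun ω => s.fold max 0 (fun y => y * M (g ⁻¹' {y}) ω)) P := by
    intro s
    induction s using Finset.induction_on with
    | empty => simp
    | insert y s hy ih =>
      simp only [Finset.fold_insert hy]
      refine AEMeasurable.max ?_ ih
      by_cases h0 : y = 0
      · simp [h0]
      · exact (hM.isFrechet _ (g.measurableSet_fiber _)
          (SimpleFunc.finMeasSupp_iff.1 hg _ h0)).1.const_mul _
  exact key g.range

/-- The event is the intersection of the independent events `M {g = y} ≤ x / y` over `y ≠ 0`, so the
Fréchet exponents add up. -/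
theorem measureReal_simpleExtremalIntegral_le (hα : 0 < α) (hM : IsFrechetSupMeasure α μ P M)
    (g : SimpleFunc S ℝ) (hg : g.FinMeasSupp μ) (hg0 : ∀ s, 0 ≤ g s) {x : ℝ} (hx : 0 < x) :
    P.real {ω | simpleExtremalIntegral M g ω ≤ x} =
      Real.exp (-((lpPow α μ g).toReal * x ^ (-α))) := by
  have hfin : ∀ y : {y // y ∈ g.range.filter (· ≠ 0)}, μ (g ⁻¹' {y.1}) < ⊤ := fun y =>
    SimpleFunc.finMeasSupp_iff.1 hg _ (Finset.mem_filter.1 y.2).2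
  have hpos : ∀ y : {y // y ∈ g.range.filter (· ≠ 0)}, 0 < y.1 := fun y => by
    obtain ⟨h1, h2⟩ := Finset.mem_filter.1 y.2
    obtain ⟨s, hs⟩ := SimpleFunc.mem_range.1 h1
    exact lt_of_le_of_ne (hs ▸ hg0 s) h2.symm
  have hlaw := fun y : {y // y ∈ g.range.filter (· ≠ 0)} =>
    hM.isFrechet _ (g.measurableSet_fiber y.1) (hfin y)
  have hind : iIndepFun (fun (y : {y // y ∈ g.range.filter (· ≠ 0)}) => M (g ⁻¹' {y.1})) P :=
    hM.indep.iIndepFun _ (fun y => g.measurableSet_fiber y.1) hfin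
      (fun i j hij => pairwise_disjoint_preimage_singleton g (Subtype.coe_injective.ne hij))
  have hset : {ω | simpleExtremalIntegral M g ω ≤ x} =
      ⋂ y : {y // y ∈ g.range.filter (· ≠ 0)}, M (g ⁻¹' {y.1}) ⁻¹' Set.Iic (x / y.1) := by
    ext ω
    simp only [Set.mem_ofPred_eq, simpleExtremalIntegral_le_iff _ _ _ hx.le, Set.mem_iInter,
      Set.mem_preimage, Set.mem_Iic]
    constructor
    · intro h y
      rw [le_div_iff₀ (hpos y), mul_comm]
      exact h y (Finset.mem_filter.1 y.2).1
    · intro h y hy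
      by_cases h0 : y = 0
      · simpa [h0] using hx.le
      · have h1 := h ⟨y, Finset.mem_filter.2 ⟨hy, h0⟩⟩
        rwa [le_div_iff₀ (hpos ⟨y, Finset.mem_filter.2 ⟨hy, h0⟩⟩), mul_comm] at h1
  have hmul := hind.meas_iInter (s := fun y => M (g ⁻¹' {y.1}) ⁻¹' Set.Iic (x / y.1))
    (fun y => ⟨_, measurableSet_Iic, rfl⟩)
  rw [hset, Measure.real, hmul, ENNReal.toReal_prod, lpPow_simpleFunc_toReal hα g hg,
    Finset.sum_mul, ← Finset.sum_coe_sort (g.range.filter (· ≠ 0)), ← Finset.sum_neg_distrib,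
    Real.exp_sum]
  refine Finset.prod_congr rfl fun y _ => ?_
  have := (hlaw y).2.2 (x / y.1) (div_pos hx (hpos y))
  refine this.trans ?_
  congr 2
  rw [← Real.rpow_mul measureReal_nonneg, one_div_mul_cancel hα.ne', Real.rpow_one,
    Real.div_rpow hx.le (hpos y).le, abs_of_pos (hpos y), Real.rpow_neg (hpos y).le, div_inv_eq_mul]
  ring

end IsFrechetSupMeasure

end ExtremalIntegrals

/-! ### Convergence in `L^α` versus `L^1` convergence of `α`-th powers -/

section LpPow

/-- By homogeneity one may take `b = 1`. Near `1` continuity of `x ^ p` bounds the left side by `ε`;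
away from `1` it is dominated by a multiple of `|x - 1| ^ p`. No distinction between `p ≤ 1` and `p
> 1` is needed. -/
theorem exists_abs_rpow_sub_rpow_le {p ε : ℝ} (hp : 0 < p) (hε : 0 < ε) :
    ∃ C : ℝ, 0 < C ∧ ∀ a b : ℝ, 0 ≤ a → 0 ≤ b →
      |a ^ p - b ^ p| ≤ C * |a - b| ^ p + ε * b ^ p := by
  have hc : ContinuousAt (fun x : ℝ => x ^ p) 1 :=
    Real.continuousAt_rpow_const _ _ (Or.inl one_ne_zero)
  obtain ⟨δ, hδ, h⟩ := Metric.continuousAt_iff.1 hc ε hε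
  simp only [Real.dist_eq, Real.one_rpow] at h
  have key : ∀ x : ℝ, 0 ≤ x → |x ^ p - 1| ≤ (1 / δ + 1) ^ p * |x - 1| ^ p + ε := by
    intro x hx
    rcases lt_or_ge |x - 1| δ with hlt | hge
    · exact (h hlt).le.trans (le_add_of_nonneg_left (by positivity))
    · refine le_add_of_le_of_nonneg ?_ hε.le
      rw [← Real.mul_rpow (by positivity) (abs_nonneg _)]
      -- Both `1` and `x ≤ 1 + |x - 1|` are then at most `(1 / δ + 1) * |x - 1|`, which explains the
      -- constant.
      have h1 : 1 ≤ 1 / δ * |x - 1| := by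
        rw [one_div, inv_mul_eq_div, le_div_iff₀ hδ, one_mul]
        exact hge
      have hx0 : 0 ≤ |x - 1| := abs_nonneg _
      have h2 : 1 ≤ ((1 / δ + 1) * |x - 1|) ^ p := Real.one_le_rpow (by linarith) hp.le
      have h3 : x ^ p ≤ ((1 / δ + 1) * |x - 1|) ^ p :=
        Real.rpow_le_rpow hx (by linarith [le_abs_self (x - 1)]) hp.le
      have h4 : 0 ≤ x ^ p := Real.rpow_nonneg hx p
      rw [abs_le]
      constructor <;> linarith
  have hC : 1 ≤ (1 / δ + 1) ^ p := Real.one_le_rpow (by simp [hδ.le]) hp.le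
  refine ⟨(1 / δ + 1) ^ p, by positivity, fun a b ha hb => ?_⟩
  rcases hb.eq_or_lt with rfl | hb
  · rw [Real.zero_rpow hp.ne', sub_zero, sub_zero, mul_zero, add_zero,
      abs_of_nonneg (Real.rpow_nonneg ha p), abs_of_nonneg ha]
    exact le_mul_of_one_le_left (Real.rpow_nonneg ha p) hC
  · have hbp : 0 < b ^ p := Real.rpow_pos_of_pos hb p
    have h1 := mul_le_mul_of_nonneg_right (key (a / b) (by positivity)) hbp.le
    have e1 : |(a / b) ^ p - 1| * b ^ p = |a ^ p - b ^ p| := by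
      rw [Real.div_rpow ha hb.le, ← abs_of_pos hbp, ← abs_mul, abs_of_pos hbp]
      congr 1
      field_simp
    have e2 : |a / b - 1| ^ p * b ^ p = |a - b| ^ p := by
      rw [← Real.mul_rpow (abs_nonneg _) hb.le, ← abs_of_pos hb, ← abs_mul, abs_of_pos hb]
      congr 2
      field_simp
    rw [e1, add_mul, mul_assoc, e2] at h1
    exact h1

theorem enorm_rpow_eq_ofReal {p : ℝ} (hp : 0 < p) (a : ℝ) :
    ‖a‖ₑ ^ p = ENNReal.ofReal (|a| ^ p) := by
  rw [Real.enorm_eq_ofReal_abs, ENNReal.ofReal_rpow_of_nonneg (abs_nonneg a) hp.le]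

theorem exists_enorm_rpow_sub_rpow_le {p ε : ℝ} (hp : 0 < p) (hε : 0 < ε) :
    ∃ C : ℝ, ∀ a b : ℝ, ‖|a| ^ p - |b| ^ p‖ₑ ≤
      ENNReal.ofReal C * ‖a - b‖ₑ ^ p + ENNReal.ofReal ε * ‖b‖ₑ ^ p := by
  obtain ⟨C, hC, h⟩ := exists_abs_rpow_sub_rpow_le hp hε
  refine ⟨C, fun a b => ?_⟩
  rw [enorm_rpow_eq_ofReal hp, enorm_rpow_eq_ofReal hp, ← ENNReal.ofReal_mul hC.le,
    ← ENNReal.ofReal_mul hε.le, ← ENNReal.ofReal_add (by positivity) (by positivity),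
    Real.enorm_eq_ofReal_abs]
  refine ENNReal.ofReal_le_ofReal ((h |a| |b| (abs_nonneg a) (abs_nonneg b)).trans ?_)
  have := Real.rpow_le_rpow (abs_nonneg _) (abs_abs_sub_abs_le_abs_sub a b) hp.le
  gcongr

/-- The previous scalar estimate with exponent `1/p`, applied to `a ^ p` and `b ^ p`, then raised to
the power `p`. -/
theorem exists_enorm_sub_rpow_le {p ε : ℝ} (hp : 0 < p) (hε : 0 < ε) :
    ∃ C : ℝ, ∀ a b : ℝ, 0 ≤ a → 0 ≤ b → ‖a - b‖ₑ ^ p ≤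
      ENNReal.ofReal C * ‖|a| ^ p - |b| ^ p‖ₑ + ENNReal.ofReal ε * ‖b‖ₑ ^ p := by
  -- This tolerance becomes `ε` after raising to the power `p` and paying the factor `2 ^ p` in `(x
  -- + y)^p ≤ 2^p (x^p + y^p)`.
  have hε' : 0 < (ε / 2 ^ p) ^ p⁻¹ := by positivity
  obtain ⟨C, hC, h⟩ := exists_abs_rpow_sub_rpow_le (inv_pos.2 hp) hε'
  refine ⟨2 ^ p * C ^ p, fun a b ha hb => ?_⟩
  have h2 : (0 : ℝ) ≤ 2 ^ p * C ^ p := by positivity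
  rw [enorm_rpow_eq_ofReal hp, enorm_rpow_eq_ofReal hp, Real.enorm_eq_ofReal_abs,
    ← ENNReal.ofReal_mul h2,
    ← ENNReal.ofReal_mul hε.le, ← ENNReal.ofReal_add (by positivity) (by positivity)]
  refine ENNReal.ofReal_le_ofReal ?_
  rw [abs_of_nonneg ha, abs_of_nonneg hb]
  have h1 := h (a ^ p) (b ^ p) (by positivity) (by positivity)
  rw [Real.rpow_rpow_inv ha hp.ne', Real.rpow_rpow_inv hb hp.ne'] at h1
  set x := C * |a ^ p - b ^ p| ^ p⁻¹ with hx
  set y := (ε / 2 ^ p) ^ p⁻¹ * b with hy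
  have hx0 : 0 ≤ x := by positivity
  have hy0 : 0 ≤ y := by positivity
  have hxp : x ^ p = C ^ p * |a ^ p - b ^ p| := by
    rw [hx, Real.mul_rpow hC.le (by positivity), Real.rpow_inv_rpow (abs_nonneg _) hp.ne']
  have hyp : y ^ p = ε / 2 ^ p * b ^ p := by
    rw [hy, Real.mul_rpow hε'.le hb, Real.rpow_inv_rpow (by positivity) hp.ne']
  calc |a - b| ^ p ≤ (2 * max x y) ^ p := by
        refine Real.rpow_le_rpow (abs_nonneg _) (h1.trans ?_) hp.le
        linarith [le_max_left x y, le_max_right x y]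
    _ = 2 ^ p * (max x y) ^ p := Real.mul_rpow (by norm_num) (le_max_of_le_left hx0)
    _ ≤ 2 ^ p * (x ^ p + y ^ p) := by
        gcongr
        rcases max_cases x y with ⟨e, _⟩ | ⟨e, _⟩ <;> rw [e]
        · exact le_add_of_nonneg_right (by positivity)
        · exact le_add_of_nonneg_left (by positivity)
    _ = 2 ^ p * C ^ p * |a ^ p - b ^ p| + ε * b ^ p := by
        rw [hxp, hyp]
        field_simp

/-- The upper limit of `u` is at most `ε * K` for every `ε`. Here `K` will be the finite `α`-th
moment of the limiting kernel. -/
theorem tendsto_zero_of_forall_le_mul_add {u v : ℕ → ℝ≥0∞} {K : ℝ≥0∞} (hK : K ≠ ⊤)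
    (hv : Tendsto v atTop (𝓝 0))
    (h : ∀ ε : ℝ, 0 < ε → ∃ C : ℝ, ∀ n, u n ≤ ENNReal.ofReal C * v n + ENNReal.ofReal ε * K) :
    Tendsto u atTop (𝓝 0) := by
  rw [ENNReal.tendsto_nhds_zero]
  intro η hη
  obtain ⟨ε, hε, hεK⟩ : ∃ ε : ℝ, 0 < ε ∧ ENNReal.ofReal ε * K < η := by
    have : Tendsto (fun ε : ℝ => ENNReal.ofReal ε * K) (𝓝[>] 0) (𝓝 (ENNReal.ofReal 0 * K)) :=
      ENNReal.Tendsto.mul_const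
        ((ENNReal.continuous_ofReal.tendsto 0).mono_left nhdsWithin_le_nhds) (Or.inr hK)
    rw [ENNReal.ofReal_zero, zero_mul] at this
    obtain ⟨ε, h1, h2⟩ := ((this.eventually_lt_const hη).and self_mem_nhdsWithin).exists
    exact ⟨ε, h2, h1⟩
  obtain ⟨C, hC⟩ := h ε hε
  have h1 : Tendsto (fun n => ENNReal.ofReal C * v n + ENNReal.ofReal ε * K) atTop
      (𝓝 (ENNReal.ofReal C * 0 + ENNReal.ofReal ε * K)) :=
    (ENNReal.Tendsto.const_mul hv (Or.inr ENNReal.ofReal_ne_top)).add_const _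
  rw [mul_zero, zero_add] at h1
  filter_upwards [h1.eventually_lt_const hεK] with n hn using (hC n).trans hn.le

variable {S : Type*} [MeasurableSpace S] {α : ℝ} {μ : Measure S}

theorem lpPow_eq_eLpNorm_rpow (hα : 0 < α) (F : S → ℝ) :
    lpPow α μ F = eLpNorm F (ENNReal.ofReal α) μ ^ α := by
  rw [eLpNorm_eq_lintegral_rpow_enorm_toReal (by simpa using hα) ENNReal.ofReal_ne_top,
    ENNReal.toReal_ofReal hα.le, ← ENNReal.rpow_mul, one_div_mul_cancel hα.ne', ENNReal.rpow_one]
  rfl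

theorem lpPow_ne_top_of_memLp (hα : 0 < α) {F : S → ℝ} (hF : MemLp F (ENNReal.ofReal α) μ) :
    lpPow α μ F ≠ ⊤ := by
  rw [lpPow_eq_eLpNorm_rpow hα]
  exact ENNReal.rpow_ne_top_of_nonneg hα.le hF.2.ne

theorem tendsto_lpPow_zero_of_tendsto_eLpNorm (hα : 0 < α) {G : ℕ → S → ℝ}
    (h : Tendsto (fun n => eLpNorm (G n) (ENNReal.ofReal α) μ) atTop (𝓝 0)) :
    Tendsto (fun n => lpPow α μ (G n)) atTop (𝓝 0) := by
  simp_rw [lpPow_eq_eLpNorm_rpow hα]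
  have := h.ennrpow_const α
  rwa [ENNReal.zero_rpow_of_pos hα] at this

/-- A quasi-triangle inequality valid for every `α > 0`, including `α < 1` where Minkowski's
inequality fails. -/
theorem lpPow_add_le (hα : 0 < α) {F G : S → ℝ} (hG : AEMeasurable G μ) :
    lpPow α μ (fun s => F s + G s) ≤ 2 ^ α * (lpPow α μ F + lpPow α μ G) := by
  unfold lpPow
  rw [← lintegral_add_right' _ (hG.enorm.pow_const α),
    ← lintegral_const_mul' _ _ (ENNReal.rpow_ne_top_of_nonneg hα.le (by simp))]
  refine lintegral_mono fun s => ?_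
  calc ‖F s + G s‖ₑ ^ α ≤ (2 * max ‖F s‖ₑ ‖G s‖ₑ) ^ α := by
        refine ENNReal.rpow_le_rpow ((enorm_add_le _ _).trans ?_) hα.le
        rw [two_mul]
        exact add_le_add (le_max_left _ _) (le_max_right _ _)
    _ = 2 ^ α * max ‖F s‖ₑ ‖G s‖ₑ ^ α := ENNReal.mul_rpow_of_nonneg _ _ hα.le
    _ ≤ 2 ^ α * (‖F s‖ₑ ^ α + ‖G s‖ₑ ^ α) := by
        gcongr
        rcases max_cases ‖F s‖ₑ ‖G s‖ₑ with ⟨e, _⟩ | ⟨e, _⟩ <;> rw [e]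
        · exact le_add_of_nonneg_right zero_le
        · exact le_add_of_nonneg_left zero_le

theorem tendsto_lintegral_rpow_sub_rpow (hα : 0 < α) {G : ℕ → S → ℝ} {F : S → ℝ}
    (hF : AEMeasurable F μ) (hF' : lpPow α μ F ≠ ⊤)
    (h : Tendsto (fun n => lpPow α μ (fun s => G n s - F s)) atTop (𝓝 0)) :
    Tendsto (fun n => ∫⁻ s, ‖|G n s| ^ α - |F s| ^ α‖ₑ ∂μ) atTop (𝓝 0) := by
  refine tendsto_zero_of_forall_le_mul_add hF' h fun ε hε => ?_
  obtain ⟨C, hC⟩ := exists_enorm_rpow_sub_rpow_le hα hε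
  refine ⟨C, fun n => ?_⟩
  unfold lpPow
  rw [← lintegral_const_mul' _ _ ENNReal.ofReal_ne_top,
    ← lintegral_const_mul' _ _ ENNReal.ofReal_ne_top,
    ← lintegral_add_right' _ ((hF.enorm.pow_const α).const_mul _)]
  exact lintegral_mono fun s => hC _ _

theorem tendsto_lpPow_sub_of_tendsto_lintegral (hα : 0 < α) {G : ℕ → S → ℝ} {F : S → ℝ}
    (hG0 : ∀ n, ∀ᵐ s ∂μ, 0 ≤ G n s) (hF0 : ∀ᵐ s ∂μ, 0 ≤ F s)
    (hF : AEMeasurable F μ) (hF' : lpPow α μ F ≠ ⊤)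
    (h : Tendsto (fun n => ∫⁻ s, ‖|G n s| ^ α - |F s| ^ α‖ₑ ∂μ) atTop (𝓝 0)) :
    Tendsto (fun n => lpPow α μ (fun s => G n s - F s)) atTop (𝓝 0) := by
  refine tendsto_zero_of_forall_le_mul_add hF' h fun ε hε => ?_
  obtain ⟨C, hC⟩ := exists_enorm_sub_rpow_le hα hε
  refine ⟨C, fun n => ?_⟩
  unfold lpPow
  rw [← lintegral_const_mul' _ _ ENNReal.ofReal_ne_top,
    ← lintegral_const_mul' _ _ ENNReal.ofReal_ne_top,
    ← lintegral_add_right' _ ((hF.enorm.pow_const α).const_mul _)]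
  refine lintegral_mono_ae ?_
  filter_upwards [hG0 n, hF0] with s h1 h2 using hC _ _ h1 h2

theorem lpPow_le_add (hα : 0 < α) {F : S → ℝ} (G : S → ℝ) (hF : AEMeasurable F μ) :
    lpPow α μ G ≤ ∫⁻ s, ‖|G s| ^ α - |F s| ^ α‖ₑ ∂μ + lpPow α μ F := by
  unfold lpPow
  rw [← lintegral_add_right' _ (hF.enorm.pow_const α)]
  refine lintegral_mono fun s => ?_
  simp only [enorm_rpow_eq_ofReal hα]
  rw [Real.enorm_eq_ofReal_abs]
  rw [← ENNReal.ofReal_add (by positivity) (by positivity)]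
  refine ENNReal.ofReal_le_ofReal ?_
  linarith [le_abs_self (|G s| ^ α - |F s| ^ α)]

theorem tendsto_lpPow (hα : 0 < α) {G : ℕ → S → ℝ} {F : S → ℝ}
    (hG : ∀ n, AEMeasurable (G n) μ) (hF : AEMeasurable F μ) (hF' : lpPow α μ F ≠ ⊤)
    (h : Tendsto (fun n => lpPow α μ (fun s => G n s - F s)) atTop (𝓝 0)) :
    Tendsto (fun n => lpPow α μ (G n)) atTop (𝓝 (lpPow α μ F)) := by
  have h1 := tendsto_lintegral_rpow_sub_rpow hα hF hF' h
  have hlow : Tendsto (fun n => lpPow α μ F - ∫⁻ s, ‖|G n s| ^ α - |F s| ^ α‖ₑ ∂μ) atTop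
      (𝓝 (lpPow α μ F - 0)) := ENNReal.Tendsto.sub tendsto_const_nhds h1 (Or.inl hF')
  have hup := h1.add_const (lpPow α μ F)
  rw [tsub_zero] at hlow
  rw [zero_add] at hup
  refine tendsto_of_tendsto_of_tendsto_of_le_of_le hlow hup (fun n => ?_)
    (fun n => lpPow_le_add hα (G n) hF)
  rw [tsub_le_iff_left]
  have := lpPow_le_add hα F (hG n)
  simpa only [enorm_sub_rev] using this

/-- This integrates `|x - y| + x + y = 2 max(x, y)` for `x = G^α`, `y = F^α`; the additive form
avoids truncated subtraction. -/
theorem lintegral_rpow_sub_rpow_add (hα : 0 < α) {F G : S → ℝ} (hF : AEMeasurable F μ)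
    (hG : AEMeasurable G μ) (hF0 : ∀ᵐ s ∂μ, 0 ≤ F s) (hG0 : ∀ᵐ s ∂μ, 0 ≤ G s) :
    ∫⁻ s, ‖|G s| ^ α - |F s| ^ α‖ₑ ∂μ + lpPow α μ G + lpPow α μ F =
      2 * lpPow α μ (fun s => max (G s) (F s)) := by
  unfold lpPow
  rw [← lintegral_add_right' _ (hG.enorm.pow_const α),
    ← lintegral_add_right' _ (hF.enorm.pow_const α), ← lintegral_const_mul' _ _ (by simp)]
  refine lintegral_congr_ae ?_
  filter_upwards [hF0, hG0] with s h1 h2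
  simp only [enorm_rpow_eq_ofReal hα]
  rw [Real.enorm_eq_ofReal_abs]
  rw [← ENNReal.ofReal_ofNat 2, ← ENNReal.ofReal_mul (by norm_num),
    ← ENNReal.ofReal_add (by positivity) (by positivity),
    ← ENNReal.ofReal_add (by positivity) (by positivity)]
  congr 1
  rw [abs_of_nonneg h1, abs_of_nonneg h2, abs_of_nonneg (le_max_of_le_left h2)]
  rcases le_total (G s) (F s) with h | h
  · rw [max_eq_right h, abs_of_nonpos (by linarith [Real.rpow_le_rpow h2 h hα.le])]
    ring
  · rw [max_eq_left h, abs_of_nonneg (by linarith [Real.rpow_le_rpow h1 h hα.le])]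
    ring

theorem lpPow_max_le {F G : S → ℝ} (hF : AEMeasurable F μ) :
    lpPow α μ (fun s => max (G s) (F s)) ≤ lpPow α μ G + lpPow α μ F := by
  unfold lpPow
  rw [← lintegral_add_right' _ (hF.enorm.pow_const α)]
  refine lintegral_mono fun s => ?_
  rcases max_cases (G s) (F s) with ⟨e, _⟩ | ⟨e, _⟩ <;> simp only [e]
  · exact le_add_of_nonneg_right zero_le
  · exact le_add_of_nonneg_left zero_le

theorem lpPow_mono_ae (hα : 0 < α) {F G : S → ℝ} (hF0 : ∀ᵐ s ∂μ, 0 ≤ F s)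
    (h : ∀ᵐ s ∂μ, F s ≤ G s) : lpPow α μ F ≤ lpPow α μ G := by
  refine lintegral_mono_ae ?_
  filter_upwards [hF0, h] with s h1 h2
  refine ENNReal.rpow_le_rpow ?_ hα.le
  rw [Real.enorm_eq_ofReal_abs, Real.enorm_eq_ofReal_abs, abs_of_nonneg h1,
    abs_of_nonneg (h1.trans h2)]
  exact ENNReal.ofReal_le_ofReal h2

/-- Monotone convergence for `lpPow`. -/
theorem tendsto_lpPow_of_monotone (hα : 0 < α) {G : ℕ → S → ℝ} {F : S → ℝ}
    (hG : ∀ n, AEMeasurable (G n) μ) (hG0 : ∀ n s, 0 ≤ G n s)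
    (h : ∀ᵐ s ∂μ, Monotone (fun n => G n s) ∧ Tendsto (fun n => G n s) atTop (𝓝 (F s))) :
    Tendsto (fun n => lpPow α μ (G n)) atTop (𝓝 (lpPow α μ F)) := by
  refine lintegral_tendsto_of_tendsto_of_monotone (fun n => (hG n).enorm.pow_const α) ?_ ?_
  · filter_upwards [h] with s hs m n hmn
    refine ENNReal.rpow_le_rpow ?_ hα.le
    rw [Real.enorm_eq_ofReal_abs, Real.enorm_eq_ofReal_abs, abs_of_nonneg (hG0 m s),
      abs_of_nonneg (hG0 n s)]
    exact ENNReal.ofReal_le_ofReal (hs.1 hmn)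
  · filter_upwards [h] with s hs
    exact hs.2.enorm.ennrpow_const α

end LpPow

/-! ### Convergence in probability and laws -/

section Convergence

variable {Ω : Type*} [MeasurableSpace Ω] {P : Measure Ω}

theorem tendstoInMeasure_of_abs_sub_le {U V W : ℕ → Ω → ℝ} {U₀ V₀ W₀ : Ω → ℝ}
    (hV : TendstoInMeasure P V atTop V₀) (hW : TendstoInMeasure P W atTop W₀)
    (h : ∀ n ω, |U n ω - U₀ ω| ≤ |V n ω - V₀ ω| + |W n ω - W₀ ω|) :
    TendstoInMeasure P U atTop U₀ := by
  rw [tendstoInMeasure_iff_norm] at *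
  intro ε hε
  have h1 := (hV (ε / 2) (half_pos hε)).add (hW (ε / 2) (half_pos hε))
  rw [add_zero] at h1
  refine tendsto_of_tendsto_of_tendsto_of_le_of_le tendsto_const_nhds h1 (fun _ => zero_le)
    fun n => (measure_mono fun ω hω => ?_).trans (measure_union_le _ _)
  simp only [Real.norm_eq_abs, Set.mem_union, Set.mem_ofPred_eq] at hω ⊢
  by_contra! hc
  linarith [h n ω, hc.1, hc.2]

theorem tendstoInMeasure_sub {V W : ℕ → Ω → ℝ} {V₀ W₀ : Ω → ℝ}
    (hV : TendstoInMeasure P V atTop V₀) (hW : TendstoInMeasure P W atTop W₀) :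
    TendstoInMeasure P (fun n ω => V n ω - W n ω) atTop (fun ω => V₀ ω - W₀ ω) :=
  tendstoInMeasure_of_abs_sub_le hV hW fun n ω => by
    rw [sub_sub_sub_comm]
    exact abs_sub _ _

theorem tendstoInMeasure_max {V W : ℕ → Ω → ℝ} {V₀ W₀ : Ω → ℝ}
    (hV : TendstoInMeasure P V atTop V₀) (hW : TendstoInMeasure P W atTop W₀) :
    TendstoInMeasure P (fun n ω => max (V n ω) (W n ω)) atTop (fun ω => max (V₀ ω) (W₀ ω)) :=
  tendstoInMeasure_of_abs_sub_le hV hW fun _ _ =>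
    (abs_max_sub_max_le_max _ _ _ _).trans
      (max_le_add_of_nonneg (abs_nonneg _) (abs_nonneg _))

theorem tendsto_charFun_of_tendstoInMeasure [IsProbabilityMeasure P] {V : ℕ → Ω → ℝ} {V₀ : Ω → ℝ}
    (hV : TendstoInMeasure P V atTop V₀) (hm : ∀ n, AEMeasurable (V n) P) (u : ℝ) :
    Tendsto (fun n => charFun (P.map (V n)) u) atTop (𝓝 (charFun (P.map V₀) u)) := by
  have h := (hV.tendstoInDistribution hm).tendsto
  exact ProbabilityMeasure.tendsto_iff_tendsto_charFun.1 h u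

/-- The tail is bounded by the integral of `1 - charFun` over `[-R, R]`, where the integrand is at
most `1 - exp (-c n * R ^ α)`. -/
theorem tendsto_measure_le_abs_of_charFun [IsProbabilityMeasure P] {α : ℝ} (hα : 0 < α)
    {V : ℕ → Ω → ℝ} (hm : ∀ n, AEMeasurable (V n) P) {c : ℕ → ℝ} (hc0 : ∀ n, 0 ≤ c n)
    (hV : ∀ n u, charFun (P.map (V n)) u = Complex.exp ((-(c n * |u| ^ α) : ℝ) : ℂ))
    (hc : Tendsto c atTop (𝓝 0)) {ε : ℝ} (hε : 0 < ε) :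
    Tendsto (fun n => P.real {ω | ε ≤ |V n ω|}) atTop (𝓝 0) := by
  -- The tail inequality concerns `r < |x|`, so a threshold strictly below `ε` is needed.
  set r := ε / 2 with hr
  have hr0 : 0 < r := half_pos hε
  set R := 2 * r⁻¹ with hR
  have hR0 : 0 < R := by positivity
  have hb : ∀ n, P.real {ω | ε ≤ |V n ω|} ≤
      2⁻¹ * r * ((1 - Real.exp (-(c n * R ^ α))) * |R - -R|) := by
    intro n
    have := Measure.isProbabilityMeasure_map (hm n)
    have h1 := measureReal_abs_gt_le_integral_charFun (μ := P.map (V n)) hr0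
    rw [map_measureReal_apply_of_aemeasurable (hm n) (measurableSet_lt measurable_const
      (by fun_prop)), neg_mul, ← hR] at h1
    have h2 : P.real {ω | ε ≤ |V n ω|} ≤ P.real (V n ⁻¹' {x | r < |x|}) := by
      refine measureReal_mono fun ω hω => ?_
      simp only [Set.mem_preimage, Set.mem_ofPred_eq] at hω ⊢
      linarith
    refine h2.trans (h1.trans ?_)
    gcongr
    refine intervalIntegral.norm_integral_le_of_norm_le_const fun u hu => ?_
    rw [hV n u, ← Complex.ofReal_exp, ← Complex.ofReal_one, ← Complex.ofReal_sub,
      Complex.norm_real, Real.norm_eq_abs]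
    have hu' : |u| ≤ R := by
      rw [Set.uIoc_of_le (by linarith)] at hu
      exact abs_le.2 ⟨hu.1.le, hu.2⟩
    have h3 : c n * |u| ^ α ≤ c n * R ^ α :=
      mul_le_mul_of_nonneg_left (Real.rpow_le_rpow (abs_nonneg _) hu' hα.le) (hc0 n)
    have h4 : 0 ≤ c n * |u| ^ α := mul_nonneg (hc0 n) (by positivity)
    rw [abs_of_nonneg (by simpa using h4)]
    gcongr
  refine squeeze_zero (fun _ => measureReal_nonneg) hb ?_
  have h1 : Tendsto (fun n => 2⁻¹ * r * ((1 - Real.exp (-(c n * R ^ α))) * |R - -R|)) atTop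
      (𝓝 (2⁻¹ * r * ((1 - Real.exp (-(0 * R ^ α))) * |R - -R|))) :=
    (((tendsto_const_nhds.sub ((Real.continuous_exp.tendsto _).comp
      (hc.mul_const _).neg)).mul_const _).const_mul _)
  simpa using h1

theorem tendsto_of_tendsto_exp_neg {c : ℕ → ℝ} {c₀ : ℝ}
    (h : Tendsto (fun n => Real.exp (-c n)) atTop (𝓝 (Real.exp (-c₀)))) :
    Tendsto c atTop (𝓝 c₀) := by
  have h1 := ((Real.continuousAt_log (Real.exp_ne_zero _)).tendsto.comp h).neg
  simpa [Function.comp_def] using h1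

/-! ### Fréchet distribution functions -/

section Frechet

variable [IsProbabilityMeasure P] {α : ℝ}

theorem measureReal_le_le_add (U V : Ω → ℝ) (x ε : ℝ) :
    P.real {ω | U ω ≤ x} ≤ P.real {ω | V ω ≤ x + ε} + P.real {ω | ε ≤ |U ω - V ω|} := by
  refine (measureReal_mono fun ω hω => ?_).trans (measureReal_union_le _ _)
  simp only [Set.mem_union, Set.mem_ofPred_eq] at hω ⊢
  by_contra! hc
  linarith [neg_abs_le (U ω - V ω)]

theorem continuousAt_exp_neg_mul_rpow (c : ℝ) {x : ℝ} (hx : 0 < x) :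
    ContinuousAt (fun y : ℝ => Real.exp (-(c * y ^ (-α)))) x :=
  ((continuousAt_const.mul (Real.continuousAt_rpow_const _ _ (Or.inl hx.ne'))).neg).rexp

theorem tendsto_add_nhdsGT_zero (x : ℝ) : Tendsto (fun ε : ℝ => x + ε) (𝓝[>] 0) (𝓝 x) := by
  have : Tendsto (fun ε : ℝ => x + ε) (𝓝 0) (𝓝 (x + 0)) := by
    exact (continuous_const.add continuous_id).tendsto 0
  rw [add_zero] at this
  exact this.mono_left nhdsWithin_le_nhds

theorem tendsto_sub_nhdsGT_zero (x : ℝ) : Tendsto (fun ε : ℝ => x - ε) (𝓝[>] 0) (𝓝 x) := by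
  have : Tendsto (fun ε : ℝ => x - ε) (𝓝 0) (𝓝 (x - 0)) := by
    exact (continuous_const.sub continuous_id).tendsto 0
  rw [sub_zero] at this
  exact this.mono_left nhdsWithin_le_nhds

/-- A limit in probability of Fréchet variables with converging parameters is Fréchet. -/
theorem measureReal_le_of_tendstoInMeasure {U : ℕ → Ω → ℝ} {V : Ω → ℝ} {c : ℕ → ℝ} {c₀ : ℝ}
    (h : TendstoInMeasure P U atTop V)
    (hU : ∀ n x, 0 < x → P.real {ω | U n ω ≤ x} = Real.exp (-(c n * x ^ (-α))))
    (hc : Tendsto c atTop (𝓝 c₀)) {x : ℝ} (hx : 0 < x) :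
    P.real {ω | V ω ≤ x} = Real.exp (-(c₀ * x ^ (-α))) := by
  rw [tendstoInMeasure_iff_measureReal_norm] at h
  simp only [Real.norm_eq_abs] at h
  have hlim : ∀ y : ℝ, Tendsto (fun n => Real.exp (-(c n * y ^ (-α)))) atTop
      (𝓝 (Real.exp (-(c₀ * y ^ (-α))))) := fun y =>
    (Real.continuous_exp.tendsto _).comp (hc.mul_const _).neg
  refine le_antisymm ?_ ?_
  · have h1 : ∀ᶠ ε in 𝓝[>] (0 : ℝ),
        P.real {ω | V ω ≤ x} ≤ Real.exp (-(c₀ * (x + ε) ^ (-α))) := by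
      filter_upwards [self_mem_nhdsWithin] with ε hε
      have hε' : 0 < ε := hε
      have h2 := (hlim (x + ε)).add (h ε hε')
      rw [add_zero] at h2
      refine ge_of_tendsto' h2 fun n => ?_
      rw [← hU n (x + ε) (by positivity)]
      simpa only [abs_sub_comm] using measureReal_le_le_add (P := P) V (U n) x ε
    exact ge_of_tendsto
      ((continuousAt_exp_neg_mul_rpow c₀ hx).tendsto.comp (tendsto_add_nhdsGT_zero x)) h1
  · have h1 : ∀ᶠ ε in 𝓝[>] (0 : ℝ),
        Real.exp (-(c₀ * (x - ε) ^ (-α))) ≤ P.real {ω | V ω ≤ x} := by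
      filter_upwards [Ioo_mem_nhdsGT hx] with ε hε
      have h2 := (h ε hε.1).const_add (P.real {ω | V ω ≤ x})
      rw [add_zero] at h2
      refine le_of_tendsto_of_tendsto' (hlim (x - ε)) h2 fun n => ?_
      rw [← hU n (x - ε) (by linarith [hε.2])]
      have := measureReal_le_le_add (P := P) (U n) V (x - ε) ε
      rwa [sub_add_cancel] at this
    exact le_of_tendsto
      ((continuousAt_exp_neg_mul_rpow c₀ hx).tendsto.comp (tendsto_sub_nhdsGT_zero x)) h1

/-- At `x = 1` the distribution function of `U n` is `exp (-c n)`. It is squeezed between those of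
`V` at `1 - ε` and `1 + ε`, up to a vanishing probability, and the latter are continuous at `1`. -/
theorem tendsto_of_tendstoInMeasure_frechet {U : ℕ → Ω → ℝ} {V : Ω → ℝ} {c : ℕ → ℝ} {c₀ : ℝ}
    (h : TendstoInMeasure P U atTop V)
    (hU : ∀ n x, 0 < x → P.real {ω | U n ω ≤ x} = Real.exp (-(c n * x ^ (-α))))
    (hV : ∀ x, 0 < x → P.real {ω | V ω ≤ x} = Real.exp (-(c₀ * x ^ (-α)))) :
    Tendsto c atTop (𝓝 c₀) := by
  rw [tendstoInMeasure_iff_measureReal_norm] at h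
  simp only [Real.norm_eq_abs] at h
  have hU1 : ∀ n, P.real {ω | U n ω ≤ 1} = Real.exp (-c n) := fun n => by simp [hU n 1]
  refine tendsto_of_tendsto_exp_neg ?_
  have hcont := (continuousAt_exp_neg_mul_rpow (α := α) c₀ one_pos).tendsto
  simp only [Real.one_rpow, mul_one] at hcont
  rw [tendsto_order]
  constructor
  · intro a ha
    obtain ⟨ε, h1, h2⟩ := (((hcont.comp (tendsto_sub_nhdsGT_zero 1)).eventually_const_lt ha).and
      (Ioo_mem_nhdsGT one_pos)).exists
    have h3 := (h ε h2.1).const_sub (P.real {ω | V ω ≤ 1 - ε})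
    rw [sub_zero, hV _ (by linarith [h2.2])] at h3
    filter_upwards [h3.eventually_const_lt h1] with n hn
    have h4 := measureReal_le_le_add (P := P) V (U n) (1 - ε) ε
    rw [sub_add_cancel, hU1, hV _ (by linarith [h2.2])] at h4
    simp only [abs_sub_comm (V _)] at h4
    linarith
  · intro a ha
    obtain ⟨ε, h1, h2⟩ := (((hcont.comp (tendsto_add_nhdsGT_zero 1)).eventually_lt_const ha).and
      (Ioo_mem_nhdsGT one_pos)).exists
    have h3 := (h ε h2.1).const_add (P.real {ω | V ω ≤ 1 + ε})
    rw [add_zero, hV _ (by linarith [h2.1])] at h3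
    filter_upwards [h3.eventually_lt_const h1] with n hn
    have h4 := measureReal_le_le_add (P := P) (U n) V 1 ε
    rw [hU1, hV _ (by linarith [h2.1])] at h4
    linarith

theorem measureReal_le_inter_lt {U W : Ω → ℝ} (hW : AEMeasurable W P) (hUW : ∀ ω, U ω ≤ W ω)
    (x : ℝ) : P.real {ω | U ω ≤ x ∧ x < W ω} =
      P.real {ω | U ω ≤ x} - P.real {ω | W ω ≤ x} := by
  have h := measureReal_inter_add_sdiff₀ (μ := P) (s := {ω | U ω ≤ x})
    (hW.nullMeasurableSet_preimage (measurableSet_Iic (a := x)))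
  have e1 : {ω | U ω ≤ x} ∩ W ⁻¹' Set.Iic x = {ω | W ω ≤ x} := by
    ext ω
    simp only [Set.mem_inter_iff, Set.mem_ofPred_eq, Set.mem_preimage, Set.mem_Iic]
    exact ⟨fun h => h.2, fun h => ⟨(hUW ω).trans h, h⟩⟩
  have e2 : {ω | U ω ≤ x} \ W ⁻¹' Set.Iic x = {ω | U ω ≤ x ∧ x < W ω} := by
    ext ω
    simp
  rw [e1, e2] at h
  linarith

/-- If nonnegative variables `U n ≤ W n` are Fréchet with parameters converging to the same
limit, then `W n - U n` converges to `0` in probability. -/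
theorem tendsto_measureReal_le_sub_frechet (hα : 0 < α) {U W : ℕ → Ω → ℝ} {b c : ℕ → ℝ} {c₀ : ℝ}
    (hW : ∀ n, AEMeasurable (W n) P) (hUW : ∀ n ω, U n ω ≤ W n ω)
    (hU0 : ∀ n, ∀ᵐ ω ∂P, 0 ≤ U n ω)
    (hb : ∀ n x, 0 < x → P.real {ω | U n ω ≤ x} = Real.exp (-(b n * x ^ (-α))))
    (hc : ∀ n x, 0 < x → P.real {ω | W n ω ≤ x} = Real.exp (-(c n * x ^ (-α))))
    (hb' : Tendsto b atTop (𝓝 c₀)) (hc' : Tendsto c atTop (𝓝 c₀)) {ε : ℝ} (hε : 0 < ε) :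
    Tendsto (fun n => P.real {ω | ε ≤ W n ω - U n ω}) atTop (𝓝 0) := by
  set δ := ε / 2 with hδ
  have hδ0 : 0 < δ := half_pos hε
  -- A gap of at least `2δ` between `U` and `W` contains a point of the grid `δ, 2δ, …`, and if `W ≤
  -- (N + 1) δ` one of the first `N` points suffices. The grid starts at `δ` since the Fréchet
  -- formula needs a positive argument.
  have hcover : ∀ N n, P.real {ω | ε ≤ W n ω - U n ω} ≤
      ∑ j ∈ Finset.range N, P.real {ω | U n ω ≤ (j + 1) * δ ∧ (j + 1) * δ < W n ω} +
        P.real {ω | W n ω ≤ (N + 1) * δ}ᶜ := by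
    intro N n
    have h1 : P.real {ω | ε ≤ W n ω - U n ω} ≤
        P.real ((⋃ j ∈ Finset.range N, {ω | U n ω ≤ (j + 1) * δ ∧ (j + 1) * δ < W n ω}) ∪
          {ω | W n ω ≤ (N + 1) * δ}ᶜ) := by
      refine ENNReal.toReal_mono (measure_ne_top _ _) (measure_mono_ae ?_)
      filter_upwards [hU0 n] with ω h0 hω
      change ε ≤ W n ω - U n ω at hω
      change ω ∈ (_ : Set Ω)
      by_cases hN : W n ω ≤ (N + 1) * δ
      · left
        have h2 : (⌊U n ω / δ⌋₊ : ℝ) * δ ≤ U n ω := by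
          rw [← le_div_iff₀ hδ0]
          exact Nat.floor_le (by positivity)
        have h3 : U n ω < (⌊U n ω / δ⌋₊ + 1 : ℝ) * δ := by
          rw [← div_lt_iff₀ hδ0]
          exact Nat.lt_floor_add_one _
        have h4 : (⌊U n ω / δ⌋₊ + 1 : ℝ) * δ < (N + 1) * δ := by nlinarith
        simp only [Set.mem_iUnion, Finset.mem_range, exists_prop]
        refine ⟨⌊U n ω / δ⌋₊, ?_, h3.le, by nlinarith⟩
        have := lt_of_mul_lt_mul_right h4 hδ0.le
        exact_mod_cast (add_lt_add_iff_right (1 : ℝ)).1 this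
      · right
        exact hN
    refine h1.trans ((measureReal_union_le _ _).trans ?_)
    gcongr
    exact measureReal_biUnion_finset_le _ _
  have hlim : ∀ N : ℕ, Tendsto (fun n =>
      ∑ j ∈ Finset.range N, P.real {ω | U n ω ≤ (j + 1) * δ ∧ (j + 1) * δ < W n ω} +
        P.real {ω | W n ω ≤ (N + 1) * δ}ᶜ) atTop
      (𝓝 (0 + (1 - Real.exp (-(c₀ * ((N + 1) * δ) ^ (-α)))))) := by
    intro N
    have hexp : ∀ {d : ℕ → ℝ}, Tendsto d atTop (𝓝 c₀) → ∀ x : ℝ,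
        Tendsto (fun n => Real.exp (-(d n * x ^ (-α)))) atTop
          (𝓝 (Real.exp (-(c₀ * x ^ (-α))))) := fun hd x =>
      (Real.continuous_exp.tendsto _).comp (hd.mul_const _).neg
    refine Tendsto.add ?_ ?_
    -- As `U ≤ W`, the probability that a grid point separates them is a difference of two
    -- distribution functions with the same limit.
    · rw [← Finset.sum_const_zero (s := Finset.range N)]
      refine tendsto_finsetSum _ fun j _ => ?_
      have hx : 0 < ((j : ℝ) + 1) * δ := by positivity
      have h1 := (hexp hb' (((j : ℝ) + 1) * δ)).sub (hexp hc' (((j : ℝ) + 1) * δ))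
      rw [sub_self] at h1
      refine h1.congr fun n => ?_
      rw [measureReal_le_inter_lt (hW n) (hUW n), hb n _ hx, hc n _ hx]
    · have hx : 0 < ((N : ℝ) + 1) * δ := by positivity
      refine ((hexp hc' (((N : ℝ) + 1) * δ)).const_sub 1).congr fun n => ?_
      have hm : NullMeasurableSet {ω | W n ω ≤ (N + 1) * δ} P :=
        (hW n).nullMeasurableSet_preimage measurableSet_Iic
      rw [probReal_compl_eq_one_sub₀ hm, hc n _ hx]
  have htail : Tendsto (fun N : ℕ => 0 + (1 - Real.exp (-(c₀ * (((N : ℝ) + 1) * δ) ^ (-α))))) atTop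
      (𝓝 0) := by
    have h1 : Tendsto (fun N : ℕ => ((N : ℝ) + 1) * δ) atTop atTop :=
      (tendsto_natCast_atTop_atTop.atTop_add tendsto_const_nhds).atTop_mul_const hδ0
    have h2 := (((Real.continuous_exp.tendsto _).comp
      (((tendsto_rpow_neg_atTop hα).comp h1).const_mul c₀).neg).const_sub 1).const_add 0
    simpa [Function.comp_def] using h2
  -- First `N` is chosen to make the limiting tail small, then `n` is sent to infinity.
  rw [tendsto_order]
  refine ⟨fun a ha => Eventually.of_forall fun n => ha.trans_le measureReal_nonneg, fun η hη => ?_⟩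
  obtain ⟨N, hN⟩ := (htail.eventually_lt_const hη).exists
  filter_upwards [(hlim N).eventually_lt_const hN] with n hn using (hcover N n).trans_lt hn

end Frechet

end Convergence

/-! ### Laws of differences and maxima of integrals -/

section Representation

variable {S : Type*} [MeasurableSpace S] {Ω : Type*} [MeasurableSpace Ω]
  {α : ℝ} {μ : Measure S} {P : Measure Ω} {M : Set S → Ω → ℝ}

/-- The law of the difference of two stable integrals. -/
theorem charFun_stableIntegral_sub [IsProbabilityMeasure P] (hα : 0 < α)
    (hM : IsSaSRandomMeasure α μ P M) {F G : S → ℝ} (hF : MemLp F (ENNReal.ofReal α) μ)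
    (hG : MemLp G (ENNReal.ofReal α) μ) {Z W : Ω → ℝ} (hZ : IsStableIntegral α μ P M F Z)
    (hW : IsStableIntegral α μ P M G W) (u : ℝ) :
    charFun (P.map (fun ω => Z ω - W ω)) u =
      Complex.exp ((-((lpPow α μ (fun s => F s - G s)).toReal * |u| ^ α) : ℝ) : ℂ) := by
  obtain ⟨g, hg, hgF, hgZ⟩ := hZ
  obtain ⟨h, hh, hhG, hhW⟩ := hW
  have hgh : ∀ n, (g n - h n).FinMeasSupp μ := fun n => (hg n).map₂ (hh n) (sub_zero 0)
  have hFm : AEMeasurable F μ := hF.1.aemeasurable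
  have hGm : AEMeasurable G μ := hG.1.aemeasurable
  have hlim : TendstoInMeasure P (fun n => simpleStableIntegral M (g n - h n)) atTop
      (fun ω => Z ω - W ω) :=
    (tendstoInMeasure_sub hgZ hhW).congr_left fun n => by
      filter_upwards [hM.simpleStableIntegral_sub (g n) (h n) (hg n) (hh n)] with ω hω using hω.symm
  have h1 := tendsto_charFun_of_tendstoInMeasure hlim
    (fun n => hM.aemeasurable_simpleStableIntegral _ (hgh n)) u
  simp_rw [fun n => hM.charFun_simpleStableIntegral hα _ (hgh n) u] at h1
  refine tendsto_nhds_unique h1 ?_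
  have htop : lpPow α μ (fun s => F s - G s) ≠ ⊤ := lpPow_ne_top_of_memLp hα (hF.sub hG)
  -- The quasi-triangle inequality is applied to `(g n - F) - (h n - G)`.
  have hdiff : Tendsto (fun n => lpPow α μ (fun s => (g n - h n) s - (F s - G s))) atTop (𝓝 0) := by
    have h2 := ENNReal.Tendsto.const_mul (a := (2 : ℝ≥0∞) ^ α)
      ((tendsto_lpPow_zero_of_tendsto_eLpNorm hα hgF).add
        (tendsto_lpPow_zero_of_tendsto_eLpNorm hα hhG))
      (Or.inr (ENNReal.rpow_ne_top_of_nonneg hα.le (by simp)))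
    rw [add_zero, mul_zero] at h2
    refine tendsto_of_tendsto_of_tendsto_of_le_of_le tendsto_const_nhds h2 (fun _ => zero_le)
      fun n => ?_
    have h3 := lpPow_add_le hα (F := fun s => g n s - F s) (G := fun s => -(h n s - G s))
      (((h n).measurable.aemeasurable.sub hGm).neg)
    have e1 : lpPow α μ (fun s => -(h n s - G s)) = lpPow α μ (fun s => h n s - G s) := by
      simp only [lpPow, enorm_neg]
    rw [e1] at h3
    refine le_trans (le_of_eq ?_) h3
    congr 1
    funext s
    rw [SimpleFunc.coe_sub, Pi.sub_apply]
    ring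
  have h4 := tendsto_lpPow hα (fun n => (g n - h n).measurable.aemeasurable) (hFm.sub hGm)
    htop hdiff
  have h5 := (ENNReal.tendsto_toReal htop).comp h4
  exact (Complex.continuous_exp.tendsto _).comp
    ((Complex.continuous_ofReal.tendsto _).comp (h5.mul_const _).neg)

theorem IsExtremalIntegral.tendstoInMeasure [IsProbabilityMeasure P]
    (hM : IsFrechetSupMeasure α μ P M) {g : ℕ → SimpleFunc S ℝ}
    (hg : ∀ n, (g n).FinMeasSupp μ) {Z : Ω → ℝ}
    (h : ∀ᵐ ω ∂P, Tendsto (fun n => simpleExtremalIntegral M (g n) ω) atTop (𝓝 (Z ω))) :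
    TendstoInMeasure P (fun n => simpleExtremalIntegral M (g n)) atTop Z :=
  tendstoInMeasure_of_tendsto_ae
    (fun n => (hM.aemeasurable_simpleExtremalIntegral (g n) (hg n)).aestronglyMeasurable) h

theorem IsExtremalIntegral.nonneg {F : S → ℝ} {Z : Ω → ℝ} (hZ : IsExtremalIntegral μ P M F Z) :
    ∀ᵐ ω ∂P, 0 ≤ Z ω := by
  obtain ⟨g, -, -, -, h⟩ := hZ
  filter_upwards [h] with ω hω
  exact ge_of_tendsto' hω fun n => simpleExtremalIntegral_nonneg M (g n) ω

/-- The law of the maximum of two extremal integrals. -/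
theorem measureReal_extremalIntegral_max_le [IsProbabilityMeasure P] (hα : 0 < α)
    (hM : IsFrechetSupMeasure α μ P M) {F G : S → ℝ} (hF : MemLp F (ENNReal.ofReal α) μ)
    (hG : MemLp G (ENNReal.ofReal α) μ) {Z W : Ω → ℝ} (hZ : IsExtremalIntegral μ P M F Z)
    (hW : IsExtremalIntegral μ P M G W) {x : ℝ} (hx : 0 < x) :
    P.real {ω | max (Z ω) (W ω) ≤ x} =
      Real.exp (-((lpPow α μ (fun s => max (F s) (G s))).toReal * x ^ (-α))) := by
  obtain ⟨g, hg0, hg, hgF, hgZ⟩ := hZ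
  obtain ⟨h, hh0, hh, hhG, hhW⟩ := hW
  have hgh : ∀ n, (g n ⊔ h n).FinMeasSupp μ := fun n => (hg n).map₂ (hh n) (sup_idem 0)
  have hgh0 : ∀ n s, 0 ≤ (g n ⊔ h n) s := fun n s => le_sup_of_le_left (hg0 n s)
  have hlim : TendstoInMeasure P (fun n => simpleExtremalIntegral M (g n ⊔ h n)) atTop
      (fun ω => max (Z ω) (W ω)) :=
    (tendstoInMeasure_max (IsExtremalIntegral.tendstoInMeasure hM hg hgZ)
      (IsExtremalIntegral.tendstoInMeasure hM hh hhW)).congr_left fun n => by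
      filter_upwards [hM.simpleExtremalIntegral_sup hα (g n) (h n) (hg n) (hh n) (hg0 n) (hh0 n)]
        with ω hω using hω.symm
  have htop : lpPow α μ (fun s => max (F s) (G s)) ≠ ⊤ :=
    ((lpPow_max_le hG.1.aemeasurable).trans_lt (ENNReal.add_lt_top.2
      ⟨(lpPow_ne_top_of_memLp hα hF).lt_top, (lpPow_ne_top_of_memLp hα hG).lt_top⟩)).ne
  refine measureReal_le_of_tendstoInMeasure hlim
    (fun n y hy => hM.measureReal_simpleExtremalIntegral_le hα _ (hgh n) (hgh0 n) hy) ?_ hx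
  refine (ENNReal.tendsto_toReal htop).comp (tendsto_lpPow_of_monotone hα
    (fun n => (g n ⊔ h n).measurable.aemeasurable) hgh0 ?_)
  filter_upwards [hgF, hhG] with s h1 h2
  -- The pointwise maxima still increase to `max F G`, so monotone convergence identifies the
  -- limiting scale.
  exact ⟨h1.1.sup h2.1, h1.2.max h2.2⟩

end Representation

/-! ### Convergence of associated processes in terms of kernels -/

section Association

variable {T : Type uT} {S : Type uS} [MeasurableSpace S] {ΩX : Type uX} [MeasurableSpace ΩX]
  {ΩY : Type uY} [MeasurableSpace ΩY] {PX : Measure ΩX} {PY : Measure ΩY} {α : ℝ}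
  {X : T → ΩX → ℝ} {Y : T → ΩY → ℝ} {μ : Measure S} {f : T → S → ℝ}

/-- The case `s = t` is allowed and yields the one-dimensional marginals. -/
theorem SameFDD.comp_pair {X' : T → ΩY → ℝ} (h : SameFDD PX PY X X') (s t : T)
    {u : ℝ → ℝ → ℝ} (hu : Measurable fun p : ℝ × ℝ => u p.1 p.2) :
    IdentDistrib (fun ω => u (X s ω) (X t ω)) (fun ω => u (X' s ω) (X' t ω)) PX PY := by
  classical
  have hm : Measurable (fun v : ({s, t} : Finset T) → ℝ =>
      u (v ⟨s, by simp⟩) (v ⟨t, by simp⟩)) :=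
    hu.comp (g := fun p : ℝ × ℝ => u p.1 p.2) (f := fun v : ({s, t} : Finset T) → ℝ =>
      (v ⟨s, by simp⟩, v ⟨t, by simp⟩)) (by fun_prop)
  exact (h {s, t}).comp hm

namespace AssociatedBy

theorem charFun_sub (hα : 0 < α) (h : AssociatedBy.{uT, uS, uX, uY, uP, uM} α μ f PX X PY Y)
    (s t : T) : AEMeasurable (fun ω => X s ω - X t ω) PX ∧
      ∀ u, charFun (PX.map (fun ω => X s ω - X t ω)) u =
        Complex.exp ((-((lpPow α μ (fun x => f s x - f t x)).toReal * |u| ^ α) : ℝ) : ℂ) := by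
  obtain ⟨Ω', _, P', M, Z, _, hM, hZ, hfdd⟩ := h.stable
  have hid := hfdd.comp_pair s t (u := fun a b => a - b) (by fun_prop)
  refine ⟨hid.aemeasurable_fst, fun u => ?_⟩
  rw [hid.map_eq]
  exact charFun_stableIntegral_sub hα hM (h.memLp s) (h.memLp t) (hZ s) (hZ t) u

theorem measureReal_max_le (hα : 0 < α)
    (h : AssociatedBy.{uT, uS, uX, uY, uP, uM} α μ f PX X PY Y) (s t : T) {x : ℝ} (hx : 0 < x) :
    PY.real {ω | max (Y s ω) (Y t ω) ≤ x} =
      Real.exp (-((lpPow α μ (fun x => max (f s x) (f t x))).toReal * x ^ (-α))) := by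
  obtain ⟨Ω', _, P', M, Z, _, hM, hZ, hfdd⟩ := h.extremal
  have hid := hfdd.comp_pair s t (u := fun a b => max a b) (by fun_prop)
  rw [← measureReal_extremalIntegral_max_le hα hM (h.memLp s) (h.memLp t) (hZ s) (hZ t) hx]
  exact congrArg ENNReal.toReal (hid.measure_mem_eq (measurableSet_Iic (a := x)))

theorem aemeasurable_extremal (h : AssociatedBy.{uT, uS, uX, uY, uP, uM} α μ f PX X PY Y) (t : T) :
    AEMeasurable (Y t) PY := by
  obtain ⟨Ω', _, P', M, Z, _, hM, hZ, hfdd⟩ := h.extremal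
  exact (hfdd.comp_pair t t (u := fun a _ => a) measurable_fst).aemeasurable_fst

theorem nonneg_extremal (h : AssociatedBy.{uT, uS, uX, uY, uP, uM} α μ f PX X PY Y) (t : T) :
    ∀ᵐ ω ∂PY, 0 ≤ Y t ω := by
  obtain ⟨Ω', _, P', M, Z, _, hM, hZ, hfdd⟩ := h.extremal
  exact (hfdd.comp_pair t t (u := fun a _ => a) measurable_fst).symm.ae_snd
    (p := fun y => 0 ≤ y) measurableSet_Ici (hZ t).nonneg

theorem measureReal_le (hα : 0 < α) (h : AssociatedBy.{uT, uS, uX, uY, uP, uM} α μ f PX X PY Y)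
    (t : T) {x : ℝ} (hx : 0 < x) :
    PY.real {ω | Y t ω ≤ x} = Real.exp (-((lpPow α μ (f t)).toReal * x ^ (-α))) := by
  simpa using h.measureReal_max_le hα t t hx

/-- Convergence in probability in a stable process is convergence in `L^α` of the kernels. -/
theorem tendstoInMeasure_stable_iff [IsProbabilityMeasure PX] (hα : 0 < α)
    (h : AssociatedBy.{uT, uS, uX, uY, uP, uM} α μ f PX X PY Y) (t : ℕ → T) (t₀ : T) :
    TendstoInMeasure PX (fun n => X (t n)) atTop (X t₀) ↔
      Tendsto (fun n => lpPow α μ (fun s => f (t n) s - f t₀ s)) atTop (𝓝 0) := by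
  have htop : ∀ n, lpPow α μ (fun s => f (t n) s - f t₀ s) ≠ ⊤ := fun n =>
    lpPow_ne_top_of_memLp hα ((h.memLp (t n)).sub (h.memLp t₀))
  rw [← ENNReal.tendsto_toReal_zero_iff htop]
  constructor
  · intro hX
    have hD : TendstoInMeasure PX (fun n ω => X (t n) ω - X t₀ ω) atTop (fun _ => 0) := by
      rw [tendstoInMeasure_iff_norm] at hX ⊢
      simpa using hX
    have h1 := tendsto_charFun_of_tendstoInMeasure hD (fun n => (h.charFun_sub hα (t n) t₀).1) 1
    simp_rw [fun n => (h.charFun_sub hα (t n) t₀).2 1] at h1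
    have h2 := (Complex.continuous_re.tendsto _).comp h1
    refine tendsto_of_tendsto_exp_neg ?_
    simp only [Function.comp_def, Complex.exp_ofReal_re, abs_one, Real.one_rpow, mul_one] at h2
    simpa using h2
  · intro hc
    rw [tendstoInMeasure_iff_measureReal_norm]
    intro ε hε
    exact tendsto_measure_le_abs_of_charFun hα (fun n => (h.charFun_sub hα (t n) t₀).1)
      (fun n => ENNReal.toReal_nonneg) (fun n => (h.charFun_sub hα (t n) t₀).2) hc hε

/-- Convergence in probability in a Fréchet process is convergence in `L^1` of the `α`-th powers
of the kernels. -/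
theorem tendstoInMeasure_extremal_iff [IsProbabilityMeasure PY] (hα : 0 < α)
    (h : AssociatedBy.{uT, uS, uX, uY, uP, uM} α μ f PX X PY Y) (t : ℕ → T) (t₀ : T) :
    TendstoInMeasure PY (fun n => Y (t n)) atTop (Y t₀) ↔
      Tendsto (fun n => ∫⁻ s, ‖|f (t n) s| ^ α - |f t₀ s| ^ α‖ₑ ∂μ) atTop (𝓝 0) := by
  set a := (lpPow α μ (f t₀)).toReal with ha
  set b := fun n => (lpPow α μ (f (t n))).toReal with hb
  set c := fun n => (lpPow α μ (fun s => max (f (t n) s) (f t₀ s))).toReal with hc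
  set e := fun n => ∫⁻ s, ‖|f (t n) s| ^ α - |f t₀ s| ^ α‖ₑ ∂μ with he
  have hm : ∀ i, AEMeasurable (f i) μ := fun i => (h.memLp i).1.aemeasurable
  have htop : ∀ i, lpPow α μ (f i) ≠ ⊤ := fun i => lpPow_ne_top_of_memLp hα (h.memLp i)
  have htop' : ∀ n, lpPow α μ (fun s => max (f (t n) s) (f t₀ s)) ≠ ⊤ := fun n =>
    ((lpPow_max_le (hm t₀)).trans_lt
      (ENNReal.add_lt_top.2 ⟨(htop _).lt_top, (htop _).lt_top⟩)).ne
  -- This identity converts statements about the Fréchet parameters `b`, `c`, `a` into statements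
  -- about the `L^1` distance `e`.
  have hsum : ∀ n, e n + lpPow α μ (f (t n)) + lpPow α μ (f t₀) =
      2 * lpPow α μ (fun s => max (f (t n) s) (f t₀ s)) := fun n =>
    lintegral_rpow_sub_rpow_add hα (hm t₀) (hm (t n)) (h.nonneg t₀) (h.nonneg (t n))
  have hetop : ∀ n, e n ≠ ⊤ := fun n hn => by
    have := hsum n
    rw [hn, top_add, top_add] at this
    exact ENNReal.mul_ne_top (by simp) (htop' n) this.symm
  have hsum' : ∀ n, (e n).toReal + b n + a = 2 * c n := fun n => by
    have := congrArg ENNReal.toReal (hsum n)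
    rwa [ENNReal.toReal_add (ENNReal.add_ne_top.2 ⟨hetop n, htop _⟩) (htop _),
      ENNReal.toReal_add (hetop n) (htop _), ENNReal.toReal_mul] at this
  have hbc : ∀ n, b n ≤ c n := fun n => ENNReal.toReal_mono (htop' n)
    (lpPow_mono_ae hα (h.nonneg _) (ae_of_all _ fun s => le_max_left _ _))
  have hac : ∀ n, a ≤ c n := fun n => ENNReal.toReal_mono (htop' n)
    (lpPow_mono_ae hα (h.nonneg _) (ae_of_all _ fun s => le_max_right _ _))
  rw [← ENNReal.tendsto_toReal_zero_iff hetop]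
  constructor
  · intro hY
    have hb' : Tendsto b atTop (𝓝 a) := tendsto_of_tendstoInMeasure_frechet hY
      (fun n x hx => h.measureReal_le hα (t n) hx) (fun x hx => h.measureReal_le hα t₀ hx)
    have hmax : TendstoInMeasure PY (fun n ω => max (Y (t n) ω) (Y t₀ ω)) atTop (Y t₀) := by
      refine tendstoInMeasure_of_abs_sub_le hY hY fun n ω => ?_
      have := abs_max_sub_max_le_abs (Y (t n) ω) (Y t₀ ω) (Y t₀ ω)
      rw [max_self] at this
      linarith [abs_nonneg (Y (t n) ω - Y t₀ ω)]
    have hc' : Tendsto c atTop (𝓝 a) := tendsto_of_tendstoInMeasure_frechet hmax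
      (fun n x hx => h.measureReal_max_le hα (t n) t₀ hx) (fun x hx => h.measureReal_le hα t₀ hx)
    have h1 := ((hc'.const_mul 2).sub hb').sub_const a
    rw [two_mul, add_sub_cancel_right, sub_self] at h1
    exact h1.congr fun n => by linarith [hsum' n]
  · intro he'
    -- From `2 c = e + b + a` and `b ≤ c` follows `a ≤ c ≤ e + a`.
    have hc' : Tendsto c atTop (𝓝 a) := by
      have h1 := he'.add_const a
      rw [zero_add] at h1
      exact tendsto_of_tendsto_of_tendsto_of_le_of_le tendsto_const_nhds h1 hac
        fun n => by linarith [hsum' n, hbc n]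
    have hb' : Tendsto b atTop (𝓝 a) := by
      have h1 := ((hc'.const_mul 2).sub he').sub_const a
      rw [two_mul, sub_zero, add_sub_cancel_right] at h1
      exact h1.congr fun n => by linarith [hsum' n]
    rw [tendstoInMeasure_iff_measureReal_norm]
    intro ε hε
    have hW : ∀ n, AEMeasurable (fun ω => max (Y (t n) ω) (Y t₀ ω)) PY := fun n =>
      (h.aemeasurable_extremal _).max (h.aemeasurable_extremal _)
    have h1 := tendsto_measureReal_le_sub_frechet hα (U := fun n => Y (t n)) hW
      (fun n ω => le_max_left _ _) (fun n => h.nonneg_extremal _)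
      (fun n x hx => h.measureReal_le hα (t n) hx)
      (fun n x hx => h.measureReal_max_le hα (t n) t₀ hx) hb' hc' hε
    have h2 := tendsto_measureReal_le_sub_frechet hα (U := fun _ => Y t₀) hW
      (fun n ω => le_max_right _ _) (fun n => h.nonneg_extremal _)
      (fun n x hx => h.measureReal_le hα t₀ hx)
      (fun n x hx => h.measureReal_max_le hα (t n) t₀ hx) tendsto_const_nhds hc' hε
    have h3 := h1.add h2
    rw [add_zero] at h3
    refine squeeze_zero (fun _ => measureReal_nonneg) (fun n => ?_) h3
    refine (measureReal_mono fun ω hω => ?_).trans (measureReal_union_le _ _)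
    simp only [Real.norm_eq_abs, Set.mem_union, Set.mem_ofPred_eq] at hω ⊢
    -- The distance `|Y (t n) - Y t₀|` is the gap between the maximum and the smaller of the two
    -- variables.
    rcases le_total (Y (t n) ω) (Y t₀ ω) with hle | hle
    · left
      rwa [max_eq_right hle, ← neg_sub, ← abs_of_nonpos (sub_nonpos.2 hle)]
    · right
      rwa [max_eq_left hle, ← abs_of_nonneg (sub_nonneg.2 hle)]

end AssociatedBy

end Association

end SumMaxStable

theorem mainTheorem9 {T : Type uT} {S : Type uS} [MeasurableSpace S]
    {ΩX : Type uX} [MeasurableSpace ΩX] {ΩY : Type uY} [MeasurableSpace ΩY]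
    (PX : MeasureTheory.Measure ΩX) [MeasureTheory.IsProbabilityMeasure PX]
    (PY : MeasureTheory.Measure ΩY) [MeasureTheory.IsProbabilityMeasure PY]
    (α : ℝ) (hα0 : 0 < α) (hα2 : α < 2)
    (X : T → ΩX → ℝ) (hX : SumMaxStable.IsSaSProcess α PX X)
    (Y : T → ΩY → ℝ) (hY : SumMaxStable.IsFrechetProcess α PY Y)
    (μ : MeasureTheory.Measure S) (f : T → S → ℝ)
    (hXY : SumMaxStable.AssociatedBy.{uT, uS, uX, uY, uP, uM} α μ f PX X PY Y)
    (t : ℕ → T) (t₀ : T) :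
    MeasureTheory.TendstoInMeasure PX (fun n => X (t n)) Filter.atTop (X t₀) ↔
      MeasureTheory.TendstoInMeasure PY (fun n => Y (t n)) Filter.atTop (Y t₀) := by
  rw [hXY.tendstoInMeasure_stable_iff hα0, hXY.tendstoInMeasure_extremal_iff hα0]
  have hm : AEMeasurable (f t₀) μ := (hXY.memLp t₀).1.aemeasurable
  have htop := SumMaxStable.lpPow_ne_top_of_memLp hα0 (hXY.memLp t₀)
  exact ⟨SumMaxStable.tendsto_lintegral_rpow_sub_rpow hα0 hm htop,
    SumMaxStable.tendsto_lpPow_sub_of_tendsto_lintegral hα0 (fun n => hXY.nonneg (t n))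
      (hXY.nonneg t₀) hm htop⟩
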